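/- Let $n\in\mathbb N$, $q\in(0,1)$, $T>0$, and let $f:\mathbb R^n\to\mathbb R^n$ be of class $C^2$ (in particular, $f$ may be $C^\infty$). For an absolutely continuous function $u$ on $[0,T]$ with values in $\mathbb R^n$ or in $\mathbb R^{n\times n}$, let $$D_*^q u(t)=\frac1{\Gamma(1-q)}\int_0^t (t-\tau)^{-q}u'(\tau)\,d\tau$$ be its Caputo derivative of order $q$ with starting point $0$. A solution on $[0,T]$ of an initial value problem $D_*^q u(t)=F(t,u(t))$, $u(0)=u_0$, is an absolutely continuous function $u$ on $[0,T]$ with $u(0)=u_0$ such that, for every $t\in(0,T]$, the integral defining $D_*^qu(t)$ converges absolutely and the equation holds. Consider, for $y\in\mathbb R^n$, the problem $$D_*^q x=f(x),\qquad x(0)=y. \tag{1}$$ (a) For every $y\in\mathbb R^n$, problem (1) has at most one solution on $[0,T]$; if $f$ is Lipschitz continuous on $\mathbb R^n$, it has a solution on $[0,T]$ for every $y\in\mathbb R^n$. (b) Let $x_0\in\mathbb R^n$ be such that (1) with $y=x_0$ has a solution $x$ on $[0,T]$. Then (1) has a unique solution $x(\cdot,y)$ on $[0,T]$ for every $y$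 in some neighbourhood of $x_0$; for every $t\in[0,T]$ the map $y\mapsto x(t,y)$ is (Fréchet) differentiable at $x_0$; and its matrix derivative $\Phi(t)=\dfrac{\partial x(t,y)}{\partial y}\Big|_{y=x_0}$ is a solution on $[0,T]$, and the only one, of the variational system $$D_*^q\Phi(t)=D_xf(x(t))\,\Phi(t),\qquad \Phi(0)=I,$$ where $D_xf$ is the Jacobian matrix of $f$ and $I$ is the identity matrix. (This is the system that is used to define the Lyapunov exponents of (1) along $x$.) -/

import Mathlib

open Set Filter Topology MeasureTheory
open scoped NNReal

noncomputable section

/-- The Caputo derivative of order `q ∈ (0,1)` with starting point `0`: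
`D_*^q u(t) = 1/Γ(1-q) ∫₀ᵗ (t-τ)^(-q) u'(τ) dτ`. -/
def caputoDeriv {E : Type*} [NormedAddCommGroup E] [NormedSpace ℝ E]
    (q : ℝ) (u : ℝ → E) (t : ℝ) : E :=
  (Real.Gamma (1 - q))⁻¹ • ∫ τ in (0 : ℝ)..t, (t - τ) ^ (-q) • deriv u τ

/-- `u` solves the Caputo initial value problem `D_*^q u(t) = F(t, u(t))`, `u(0) = u₀` on `[0,T]`:
`u` is absolutely continuous on `[0,T]` (so that, in finite dimension, `u'` exists almost everywhere
and is integrable), it takes the initial value `u₀`, and for every `t ∈ (0,T]` the integral that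
defines the Caputo derivative converges absolutely and the equation holds. The time `t = 0` carries
the initial condition only, since the integral from `0` to `0` is `0`. -/
structure IsCaputoSolution {E : Type*} [NormedAddCommGroup E] [NormedSpace ℝ E]
    (q T : ℝ) (F : ℝ → E → E) (u₀ : E) (u : ℝ → E) : Prop where
  initial : u 0 = u₀
  absolutelyContinuous : AbsolutelyContinuousOnInterval u 0 T
  integrable : ∀ t ∈ Ioc 0 T,
    IntervalIntegrable (fun τ => (t - τ) ^ (-q) • deriv u τ) volume 0 t
  equation : ∀ t ∈ Ioc 0 T, caputoDeriv q u t = F t (u t)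

end

/-! Write `I^p` for `fracInt p`. The semigroup law turns the Caputo problem into the Volterra
equation `u = u₀ + c I^q F(·, u)` with `c = caputoConst q`: apply `I^q` to the equation, and `I^q
I^(1-q) u'` is a multiple of `∫ u'`. All estimates are made on the Volterra equation.

The way back needs more than continuity, because a solution must be absolutely continuous and
satisfy the equation at every `t > 0`. The key is the bound `‖u t - u s‖ ≤ C (t^q - s^q)` of
`exists_rpow_modulus`. It comes from a Gronwall inequality applied to `r ↦ u (r + h) - u r` with
majorant `φ r = (r + h)^q - r^q`, whose constant does not depend on `h`. The bound gives absolute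
continuity and `‖u' t‖ ≤ D t^(q-1)`. Hence `I^(1-q) u'` is continuous on `(0, T]`, and an identity
of primitives becomes the equation at every point.

Both Gronwall and existence rest on `exists_exp_weight`: against the weight `exp (l t) φ t`, with `φ
s * s^(1-q)` nondecreasing, `I^q` has arbitrarily small norm once `l` is large.

For (b), `f` is cut off to a Lipschitz `g` with Lipschitz derivative. Solutions for `g` starting
near `x₀` stay close to `x`, where `g = f`. With `Φ` the solution of the variational system, `u - x
- Φ (y - x₀)` solves a linear Volterra equation with a source that is `O(‖y - x₀‖²)`, so it is
itself quadratically small. -/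

/-- The Riemann–Liouville integral of order `p` with starting point `0`, without the factor
`1 / Γ(p)`. -/
noncomputable def fracInt {E : Type*} [NormedAddCommGroup E] [NormedSpace ℝ E]
    (p : ℝ) (v : ℝ → E) (t : ℝ) : E :=
  ∫ s in (0 : ℝ)..t, (t - s) ^ (p - 1) • v s

/-- The beta integral with real arguments. -/
noncomputable def betaInt (p r : ℝ) : ℝ :=
  ∫ s in (0 : ℝ)..1, (1 - s) ^ (p - 1) * s ^ (r - 1)

/-! ### Power kernels and beta integrals -/

theorem intervalIntegrable_sub_rpow {p : ℝ} (hp : 0 < p) (a b c : ℝ) :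
    IntervalIntegrable (fun s => (c - s) ^ (p - 1)) volume a b := by
  have h : IntervalIntegrable (fun x : ℝ => x ^ (p - 1)) volume (c - a) (c - b) :=
    intervalIntegral.intervalIntegrable_rpow' (by linarith)
  simpa using h.comp_sub_left c

theorem integral_sub_rpow {p : ℝ} (hp : 0 < p) (a b c : ℝ) :
    ∫ s in a..b, (c - s) ^ (p - 1) = ((c - a) ^ p - (c - b) ^ p) / p := by
  rw [intervalIntegral.integral_comp_sub_left (fun x : ℝ => x ^ (p - 1)) c,
    integral_rpow (Or.inl (by linarith))]
  simp

theorem intervalIntegrable_beta {p r : ℝ} (hp : 0 < p) (hr : 0 < r) {a b : ℝ} (hab : a ≤ b) :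
    IntervalIntegrable (fun s => (b - s) ^ (p - 1) * (s - a) ^ (r - 1)) volume a b := by
  rcases hab.eq_or_lt with rfl | hab
  · exact IntervalIntegrable.refl
  have hr' : IntervalIntegrable (fun s : ℝ => (s - a) ^ (r - 1)) volume a ((a + b) / 2) := by
    have h : IntervalIntegrable (fun x : ℝ => x ^ (r - 1)) volume (a - a) ((a + b) / 2 - a) :=
      intervalIntegral.intervalIntegrable_rpow' (by linarith)
    simpa using h.comp_sub_right a
  refine IntervalIntegrable.trans (b := (a + b) / 2) ?_ ?_
  · refine hr'.continuousOn_mul fun s hs => ?_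
    rw [uIcc_of_le (by linarith)] at hs
    exact (ContinuousAt.rpow_const (by fun_prop)
      (Or.inl (by linarith [hs.2]))).continuousWithinAt
  · refine (intervalIntegrable_sub_rpow hp _ _ b).mul_continuousOn fun s hs => ?_
    rw [uIcc_of_le (by linarith)] at hs
    exact (ContinuousAt.rpow_const (by fun_prop)
      (Or.inl (by linarith [hs.1]))).continuousWithinAt

theorem integral_beta (p r : ℝ) {a b : ℝ} (hab : a < b) :
    ∫ s in a..b, (b - s) ^ (p - 1) * (s - a) ^ (r - 1)
      = betaInt p r * (b - a) ^ (p + r - 1) := by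
  have hd : 0 < b - a := sub_pos.2 hab
  have h := intervalIntegral.smul_integral_comp_mul_add (a := 0) (b := 1)
    (fun s => (b - s) ^ (p - 1) * (s - a) ^ (r - 1)) (b - a) a
  simp only [mul_zero, zero_add, mul_one, sub_add_cancel] at h
  rw [← h, betaInt, smul_eq_mul, ← intervalIntegral.integral_const_mul,
    ← intervalIntegral.integral_mul_const]
  refine intervalIntegral.integral_congr fun s hs => ?_
  rw [uIcc_of_le zero_le_one] at hs
  have h1 : b - ((b - a) * s + a) = (b - a) * (1 - s) := by ring
  have h2 : (b - a) * s + a - a = (b - a) * s := by ring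
  have h3 : (b - a) ^ (p + r - 1) = (b - a) * ((b - a) ^ (p - 1) * (b - a) ^ (r - 1)) := by
    have h4 : p + r - 1 = 1 + ((p - 1) + (r - 1)) := by ring
    rw [h4, Real.rpow_add hd, Real.rpow_add hd, Real.rpow_one]
  simp only [h1, h2]
  rw [Real.mul_rpow hd.le (by linarith [hs.2]), Real.mul_rpow hd.le hs.1, h3]
  ring

/-- Besides convergence and scaling, only symmetry and positivity of the beta integral are used,
never its value in terms of `Γ`. -/
theorem betaInt_comm (p r : ℝ) : betaInt p r = betaInt r p := by
  have h := intervalIntegral.integral_comp_sub_left (a := 0) (b := 1)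
    (fun s : ℝ => (1 - s) ^ (p - 1) * s ^ (r - 1)) 1
  simp only [sub_sub_cancel, sub_self, sub_zero] at h
  rw [betaInt, ← h, betaInt]
  simp_rw [mul_comm]

theorem betaInt_pos {p r : ℝ} (hp : 0 < p) (hr : 0 < r) : 0 < betaInt p r := by
  refine intervalIntegral.intervalIntegral_pos_of_pos_on ?_ (fun s hs => ?_) one_pos
  · simpa using intervalIntegrable_beta hp hr zero_le_one
  · have := hs.1
    have : 0 < 1 - s := by linarith [hs.2]
    positivity

/-! ### Inequalities for increments of powers -/

/-- This is Hölder's inequality for two terms: weighted AM-GM after normalising by the sums, where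
the two right-hand sides add up to 1. -/
theorem rpow_one_sub_mul_rpow_add_le {q a₁ a₂ b₁ b₂ : ℝ} (hq : q ∈ Ioo (0 : ℝ) 1) (ha₁ : 0 ≤ a₁)
    (ha₂ : 0 ≤ a₂) (hb₁ : 0 ≤ b₁) (hb₂ : 0 ≤ b₂) (ha : 0 < a₁ + a₂) (hb : 0 < b₁ + b₂) :
    a₁ ^ (1 - q) * b₁ ^ q + a₂ ^ (1 - q) * b₂ ^ q ≤ (a₁ + a₂) ^ (1 - q) * (b₁ + b₂) ^ q := by
  have key : ∀ x y : ℝ, 0 ≤ x → 0 ≤ y → x ^ (1 - q) * y ^ q ≤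
      ((1 - q) * (x / (a₁ + a₂)) + q * (y / (b₁ + b₂))) *
        ((a₁ + a₂) ^ (1 - q) * (b₁ + b₂) ^ q) := by
    intro x y hx hy
    have h := Real.geom_mean_le_arith_mean2_weighted (w₁ := 1 - q) (w₂ := q)
      (by linarith [hq.2]) hq.1.le (div_nonneg hx ha.le) (div_nonneg hy hb.le) (by ring)
    rw [Real.div_rpow hx ha.le, Real.div_rpow hy hb.le, div_mul_div_comm,
      div_le_iff₀ (by positivity)] at h
    exact h
  refine (add_le_add (key a₁ b₁ ha₁ hb₁) (key a₂ b₂ ha₂ hb₂)).trans (le_of_eq ?_)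
  rw [← add_mul]
  have : (1 - q) * (a₁ / (a₁ + a₂)) + q * (b₁ / (b₁ + b₂)) +
      ((1 - q) * (a₂ / (a₁ + a₂)) + q * (b₂ / (b₁ + b₂))) = 1 := by
    field_simp
    ring
  rw [this, one_mul]

/-- The increments of `s ↦ s ^ q` decay at most like `s ^ (q - 1)`. -/
theorem rpow_add_sub_rpow_mul_le {q h s t : ℝ} (hq : q ∈ Ioo (0 : ℝ) 1) (hh : 0 < h) (hs : 0 < s)
    (hst : s ≤ t) :
    ((s + h) ^ q - s ^ q) * s ^ (1 - q) ≤ ((t + h) ^ q - t ^ q) * t ^ (1 - q) := by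
  have ht : 0 < t := hs.trans_le hst
  -- Hölder on the pairs `(s, t - s)` and `(s + h, t - s)` gives `s^(1-q) (s+h)^q + (t - s) ≤
  -- t^(1-q) (t+h)^q`, which rearranges to the claim since `x^(1-q) x^q = x`.
  have h1 := rpow_one_sub_mul_rpow_add_le (a₁ := s) (a₂ := t - s) (b₁ := s + h) (b₂ := t - s) hq
    hs.le (by linarith) (by linarith) (by linarith) (by linarith) (by linarith)
  have h2 : ∀ x : ℝ, 0 ≤ x → x ^ (1 - q) * x ^ q = x := fun x hx => by
    rw [← Real.rpow_add' hx (by simp)]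
    simp
  rw [h2 _ (by linarith)] at h1
  have h3 : s + (t - s) = t := by ring
  have h4 : s + h + (t - s) = t + h := by ring
  rw [h3, h4] at h1
  have h5 := h2 s hs.le
  have h6 := h2 t ht.le
  nlinarith

/-- The concave function `x ^ q` lies below its tangent at `s` (Bernoulli's inequality). -/
theorem rpow_sub_rpow_le {q s t : ℝ} (hq : q ∈ Ioo (0 : ℝ) 1) (hs : 0 < s) (hst : s ≤ t) :
    t ^ q - s ^ q ≤ q * s ^ (q - 1) * (t - s) := by
  have h := rpow_one_add_le_one_add_mul_self (s := (t - s) / s) (p := q)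
    (by have := div_nonneg (sub_nonneg.2 hst) hs.le; linarith) hq.1.le hq.2.le
  have h1 : 1 + (t - s) / s = t / s := by field_simp; ring
  rw [h1, Real.div_rpow (hs.le.trans hst) hs.le, div_le_iff₀ (by positivity)] at h
  have h2 : s ^ (q - 1) = s ^ q / s := Real.rpow_sub_one hs.ne' q
  rw [h2]
  have h3 : (1 + q * ((t - s) / s)) * s ^ q = s ^ q + q * (s ^ q / s) * (t - s) := by
    field_simp
  linarith

/-! ### Composition of fractional integrals -/

section Fubini

variable {E : Type*} [NormedAddCommGroup E] [NormedSpace ℝ E]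

/-- The triangle `r < s` is encoded by an indicator on the square. Integrating out `s` leaves a
multiple of `(t - r)^(q+p-1) ‖v r‖`, integrable because the exponent is nonnegative. -/
theorem integrable_fubini_kernel {p q : ℝ} (hp : 0 < p) (hq : 0 < q) (hpq : 1 ≤ q + p)
    {v : ℝ → E} {t : ℝ} (ht : 0 ≤ t) (hv : IntervalIntegrable v volume 0 t) :
    Integrable (Function.uncurry fun s r : ℝ =>
        (Ioi r).indicator (fun s' => (t - s') ^ (q - 1) * (s' - r) ^ (p - 1)) s • v r)
      ((volume.restrict (Ioo 0 t)).prod (volume.restrict (Ioo 0 t))) := by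
  have hv' : Integrable v (volume.restrict (Ioo 0 t)) :=
    ((intervalIntegrable_iff_integrableOn_Ioo_of_le ht).1 hv)
  have hmeas : Measurable fun z : ℝ × ℝ =>
      (Ioi z.2).indicator (fun s' => (t - s') ^ (q - 1) * (s' - z.2) ^ (p - 1)) z.1 := by
    have h : (fun z : ℝ × ℝ =>
        (Ioi z.2).indicator (fun s' => (t - s') ^ (q - 1) * (s' - z.2) ^ (p - 1)) z.1) =
        {z : ℝ × ℝ | z.2 < z.1}.indicator
          (fun z => (t - z.1) ^ (q - 1) * (z.1 - z.2) ^ (p - 1)) := by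
      ext z
      simp [indicator]
    rw [h]
    exact Measurable.indicator (by fun_prop) (measurableSet_lt measurable_snd measurable_fst)
  have hker : ∀ r ∈ Ioo 0 t, Integrable
      ((Ioi r).indicator fun s' => (t - s') ^ (q - 1) * (s' - r) ^ (p - 1))
      (volume.restrict (Ioo 0 t)) := fun r hr => by
    rw [integrable_indicator_iff measurableSet_Ioi, IntegrableOn,
      Measure.restrict_restrict measurableSet_Ioi]
    have h := (intervalIntegrable_iff_integrableOn_Ioo_of_le hr.2.le).1
      (intervalIntegrable_beta hq hp hr.2.le)
    exact h.mono_set fun s hs => ⟨hs.1, hs.2.2⟩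
  rw [integrable_prod_iff']
  · constructor
    · filter_upwards [ae_restrict_mem measurableSet_Ioo] with r hr
      exact (hker r hr).smul_const (v r)
    · have h : Integrable (fun r => (betaInt q p * (t - r) ^ (q + p - 1)) * ‖v r‖)
          (volume.restrict (Ioo 0 t)) := by
        refine (intervalIntegrable_iff_integrableOn_Ioo_of_le ht).1
          (hv.norm.continuousOn_mul (Continuous.continuousOn ?_))
        exact continuous_const.mul
          ((Real.continuous_rpow_const (by linarith)).comp (by fun_prop))
      refine h.congr ?_
      filter_upwards [ae_restrict_mem measurableSet_Ioo] with r hr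
      simp only [Function.uncurry, norm_smul]
      rw [integral_mul_const, ← integral_beta q p hr.2, intervalIntegral.integral_of_le hr.2.le,
        integral_Ioc_eq_integral_Ioo]
      congr 1
      simp_rw [norm_indicator_eq_indicator_norm]
      rw [integral_indicator measurableSet_Ioi, Measure.restrict_restrict measurableSet_Ioi]
      have hset : Ioi r ∩ Ioo 0 t = Ioo r t := by
        ext s
        simp only [mem_inter_iff, mem_Ioi, mem_Ioo]
        exact ⟨fun hs => ⟨hs.1, hs.2.2⟩, fun hs => ⟨hs.1, hr.1.trans hs.1, hs.2⟩⟩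
      rw [hset]
      refine setIntegral_congr_fun measurableSet_Ioo fun s hs => ?_
      have h1 : 0 < t - s := by linarith [hs.2]
      have h2 : 0 < s - r := by linarith [hs.1]
      exact (Real.norm_of_nonneg (by positivity)).symm
  · exact hmeas.aestronglyMeasurable.smul hv'.aestronglyMeasurable.comp_snd

/-- The semigroup law of fractional integration. -/
theorem fracInt_fracInt [CompleteSpace E] {p q : ℝ} (hp : 0 < p) (hq : 0 < q) (hpq : 1 ≤ q + p)
    {v : ℝ → E} {t : ℝ} (ht : 0 ≤ t) (hv : IntervalIntegrable v volume 0 t) :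
    fracInt q (fracInt p v) t = betaInt q p • fracInt (q + p) v t := by
  have hsw := integral_integral_swap (integrable_fubini_kernel hp hq hpq ht hv)
  have hl : fracInt q (fracInt p v) t = ∫ s in Ioo 0 t, ∫ r in Ioo 0 t,
      (Ioi r).indicator (fun s' => (t - s') ^ (q - 1) * (s' - r) ^ (p - 1)) s • v r := by
    rw [fracInt, intervalIntegral.integral_of_le ht, integral_Ioc_eq_integral_Ioo]
    refine setIntegral_congr_fun measurableSet_Ioo fun s hs => ?_
    simp only [fracInt]
    rw [intervalIntegral.integral_of_le hs.1.le, integral_Ioc_eq_integral_Ioo, ← integral_smul]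
    have h : ∀ r, (Ioi r).indicator (fun s' => (t - s') ^ (q - 1) * (s' - r) ^ (p - 1)) s • v r =
        (Iio s).indicator (fun r => ((t - s) ^ (q - 1) * (s - r) ^ (p - 1)) • v r) r := fun r => by
      by_cases hr : r < s <;> simp [indicator, hr]
    simp_rw [h]
    rw [integral_indicator measurableSet_Iio, Measure.restrict_restrict measurableSet_Iio]
    have hset : Iio s ∩ Ioo 0 t = Ioo 0 s := by
      ext r
      simp only [mem_inter_iff, mem_Iio, mem_Ioo]
      exact ⟨fun hr => ⟨hr.2.1, hr.1⟩, fun hr => ⟨hr.2, hr.1, hr.2.trans hs.2⟩⟩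
    rw [hset]
    simp_rw [smul_smul]
  rw [hl, hsw, fracInt, ← intervalIntegral.integral_smul, intervalIntegral.integral_of_le ht,
    integral_Ioc_eq_integral_Ioo]
  refine setIntegral_congr_fun measurableSet_Ioo fun r hr => ?_
  rw [integral_smul_const, smul_smul, ← integral_beta q p hr.2,
    intervalIntegral.integral_of_le hr.2.le, integral_Ioc_eq_integral_Ioo,
    integral_indicator measurableSet_Ioi, Measure.restrict_restrict measurableSet_Ioi]
  have hset : Ioi r ∩ Ioo 0 t = Ioo r t := by
    ext s
    simp only [mem_inter_iff, mem_Ioi, mem_Ioo]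
    exact ⟨fun hs => ⟨hs.1, hs.2.2⟩, fun hs => ⟨hs.1, hr.1.trans hs.1, hs.2⟩⟩
  rw [hset]

theorem fracInt_one (v : ℝ → E) (t : ℝ) : fracInt 1 v t = ∫ s in (0 : ℝ)..t, v s := by
  simp [fracInt]

theorem fracInt_congr {p t : ℝ} (ht : 0 ≤ t) {v w : ℝ → E} (h : ∀ s ∈ Ioc 0 t, v s = w s) :
    fracInt p v t = fracInt p w t := by
  rw [fracInt, fracInt, intervalIntegral.integral_of_le ht, intervalIntegral.integral_of_le ht]
  exact setIntegral_congr_fun measurableSet_Ioc fun s hs => by simp only [h s hs]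

theorem fracInt_const_smul (p c : ℝ) (v : ℝ → E) (t : ℝ) :
    fracInt p (fun s => c • v s) t = c • fracInt p v t := by
  simp only [fracInt, ← intervalIntegral.integral_smul]
  simp_rw [smul_comm c]

end Fubini

/-! ### Absolutely continuous functions with finite-dimensional values -/

section AbsolutelyContinuous

variable {E : Type*} [NormedAddCommGroup E] [NormedSpace ℝ E]

theorem AbsolutelyContinuousOnInterval.clm_comp {F : Type*} [NormedAddCommGroup F]
    [NormedSpace ℝ F] (L : E →L[ℝ] F) {u : ℝ → E} {a b : ℝ}
    (hu : AbsolutelyContinuousOnInterval u a b) :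
    AbsolutelyContinuousOnInterval (fun t => L (u t)) a b := by
  refine squeeze_zero (fun _ => Finset.sum_nonneg fun i _ => dist_nonneg) (fun I => ?_)
    (by simpa using Tendsto.const_mul ‖L‖ hu)
  rw [Finset.mul_sum]
  refine Finset.sum_le_sum fun i _ => ?_
  rw [dist_eq_norm, dist_eq_norm, ← map_sub]
  exact L.le_opNorm _

theorem AbsolutelyContinuousOnInterval.of_dist_le {X Y : Type*} [PseudoMetricSpace X]
    [PseudoMetricSpace Y] {u : ℝ → X} {g : ℝ → Y} {a b : ℝ}
    (hg : AbsolutelyContinuousOnInterval g a b)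
    (h : ∀ s ∈ uIcc a b, ∀ t ∈ uIcc a b, dist (u s) (u t) ≤ dist (g s) (g t)) :
    AbsolutelyContinuousOnInterval u a b := by
  rw [absolutelyContinuousOnInterval_iff] at hg ⊢
  intro ε hε
  obtain ⟨δ, hδ, H⟩ := hg ε hε
  refine ⟨δ, hδ, fun I hI hlen => lt_of_le_of_lt (Finset.sum_le_sum fun i hi => ?_) (H I hI hlen)⟩
  exact h _ (hI.1 i hi).1 _ (hI.1 i hi).2

/-- Reduces the fundamental theorem of calculus to scalar coordinates. -/
theorem AbsolutelyContinuousOnInterval.deriv_ae_eq_sum [FiniteDimensional ℝ E] {u : ℝ → E}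
    {a b : ℝ} (hu : AbsolutelyContinuousOnInterval u a b) :
    ∀ᵐ t, t ∈ uIcc a b → deriv u t = ∑ i, deriv (fun s => (Module.finBasis ℝ E).repr (u s) i) t •
      Module.finBasis ℝ E i := by
  filter_upwards [hu.boundedVariationOn.ae_differentiableAt_of_mem_uIcc] with t ht htab
  have hd := (ht htab).hasDerivAt
  conv_lhs => rw [← (Module.finBasis ℝ E).sum_repr (deriv u t)]
  refine Finset.sum_congr rfl fun i _ => ?_
  have := ((LinearMap.toContinuousLinearMap
    ((Module.finBasis ℝ E).coord i)).hasFDerivAt.comp_hasDerivAt t hd).deriv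
  rw [← Module.Basis.coord_apply]
  congr 1
  exact this.symm

theorem AbsolutelyContinuousOnInterval.coord [FiniteDimensional ℝ E] {u : ℝ → E}
    {a b : ℝ} (hu : AbsolutelyContinuousOnInterval u a b) (i : Fin (Module.finrank ℝ E)) :
    AbsolutelyContinuousOnInterval (fun s => (Module.finBasis ℝ E).repr (u s) i) a b :=
  hu.clm_comp (LinearMap.toContinuousLinearMap ((Module.finBasis ℝ E).coord i))

theorem AbsolutelyContinuousOnInterval.intervalIntegrable_coord_smul [FiniteDimensional ℝ E]
    {u : ℝ → E} {a b : ℝ} (hu : AbsolutelyContinuousOnInterval u a b)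
    (i : Fin (Module.finrank ℝ E)) :
    IntervalIntegrable (fun t => deriv (fun s => (Module.finBasis ℝ E).repr (u s) i) t •
      Module.finBasis ℝ E i) volume a b :=
  ⟨Integrable.smul_const (hu.coord i).intervalIntegrable_deriv.1 _,
    Integrable.smul_const (hu.coord i).intervalIntegrable_deriv.2 _⟩

theorem AbsolutelyContinuousOnInterval.intervalIntegrable_deriv_of_finiteDimensional
    [FiniteDimensional ℝ E] {u : ℝ → E} {a b : ℝ} (hu : AbsolutelyContinuousOnInterval u a b) :
    IntervalIntegrable (deriv u) volume a b := by
  have h : IntervalIntegrable (fun t => ∑ i, deriv (fun s => (Module.finBasis ℝ E).repr (u s) i) t •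
      Module.finBasis ℝ E i) volume a b := by
    have := IntervalIntegrable.sum (μ := volume) (a := a) (b := b) Finset.univ
      (f := fun i t => deriv (fun s => (Module.finBasis ℝ E).repr (u s) i) t • Module.finBasis ℝ E i)
      fun i _ => hu.intervalIntegrable_coord_smul i
    simpa [Finset.sum_fn] using this
  refine h.congr_ae ?_
  rw [Filter.EventuallyEq, ae_restrict_iff' measurableSet_uIoc]
  filter_upwards [hu.deriv_ae_eq_sum] with t ht htab
  exact (ht (uIoc_subset_uIcc htab)).symm

theorem AbsolutelyContinuousOnInterval.integral_deriv_eq_sub_of_finiteDimensional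
    [FiniteDimensional ℝ E] {u : ℝ → E} {a b : ℝ} (hu : AbsolutelyContinuousOnInterval u a b) :
    ∫ t in a..b, deriv u t = u b - u a := by
  have h : ∫ t in a..b, deriv u t = ∫ t in a..b,
      ∑ i, deriv (fun s => (Module.finBasis ℝ E).repr (u s) i) t • Module.finBasis ℝ E i := by
    refine intervalIntegral.integral_congr_ae ?_
    filter_upwards [hu.deriv_ae_eq_sum] with t ht htab
    exact ht (uIoc_subset_uIcc htab)
  rw [h, intervalIntegral.integral_finsetSum
    fun i _ => hu.intervalIntegrable_coord_smul i]
  simp_rw [intervalIntegral.integral_smul_const, (hu.coord _).integral_deriv_eq_sub, sub_smul,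
    Finset.sum_sub_distrib, Module.Basis.sum_repr]

theorem absolutelyContinuousOnInterval_rpow {q : ℝ} (hq : 0 < q) (a b : ℝ) :
    AbsolutelyContinuousOnInterval (fun t : ℝ => t ^ q) a b := by
  have h := ((intervalIntegral.intervalIntegrable_rpow' (a := a) (b := b) (r := q - 1)
    (by linarith)).absolutelyContinuousOnInterval_intervalIntegral left_mem_uIcc).const_smul q
  have h2 : (fun x : ℝ => q • ∫ s in a..x, s ^ (q - 1)) = fun x => x ^ q - a ^ q := by
    ext x
    rw [integral_rpow (Or.inl (by linarith)), smul_eq_mul, sub_add_cancel]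
    field_simp
  rw [h2] at h
  refine h.of_dist_le fun s _ t _ => ?_
  simp

end AbsolutelyContinuous

/-! ### Continuity and monotonicity of fractional integrals -/

theorem continuousOn_of_norm_sub_le_rpow {E : Type*} [NormedAddCommGroup E] {G : ℝ → E} {S : Set ℝ} {K p : ℝ} (hp : 0 < p)
    (h : ∀ a ∈ S, ∀ b ∈ S, a ≤ b → ‖G b - G a‖ ≤ K * (b - a) ^ p) : ContinuousOn G S := by
  intro a ha
  have hlim : Tendsto (fun x => K * |x - a| ^ p) (𝓝[S] a) (𝓝 0) := by
    have : Continuous fun x => K * |x - a| ^ p :=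
      continuous_const.mul ((Real.continuous_rpow_const hp.le).comp (by fun_prop))
    have h0 := (this.tendsto a).mono_left (nhdsWithin_le_nhds (s := S))
    simpa [hp.ne'] using h0
  refine tendsto_iff_norm_sub_tendsto_zero.2
    (squeeze_zero' (Eventually.of_forall fun _ => norm_nonneg _) ?_ hlim)
  filter_upwards [self_mem_nhdsWithin] with x hx
  rcases le_total a x with hax | hxa
  · rw [abs_of_nonneg (sub_nonneg.2 hax)]
    exact h a ha x hx hax
  · rw [norm_sub_rev, abs_sub_comm, abs_of_nonneg (sub_nonneg.2 hxa)]
    exact h x hx a ha hxa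

section Estimates

variable {E : Type*} [NormedAddCommGroup E] [NormedSpace ℝ E]

theorem intervalIntegrable_beta_zero {p r : ℝ} (hp : 0 < p) (hr : 0 < r) {b : ℝ} (hb : 0 ≤ b) :
    IntervalIntegrable (fun s => (b - s) ^ (p - 1) * s ^ (r - 1)) volume 0 b := by
  simpa using intervalIntegrable_beta hp hr hb

theorem integral_beta_zero (p r : ℝ) {b : ℝ} (hb : 0 < b) :
    ∫ s in (0 : ℝ)..b, (b - s) ^ (p - 1) * s ^ (r - 1) = betaInt p r * b ^ (p + r - 1) := by
  simpa using integral_beta p r hb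

theorem integral_beta_zero_mono {p r : ℝ} (hp : 0 < p) (hr : 0 < r) (hpr : 1 ≤ p + r) {a b : ℝ}
    (ha : 0 ≤ a) (hab : a ≤ b) :
    ∫ s in (0 : ℝ)..a, (a - s) ^ (p - 1) * s ^ (r - 1) ≤
      ∫ s in (0 : ℝ)..b, (b - s) ^ (p - 1) * s ^ (r - 1) := by
  rcases ha.eq_or_lt with rfl | ha
  · rw [intervalIntegral.integral_same]
    refine intervalIntegral.integral_nonneg hab fun s hs => ?_
    have := sub_nonneg.2 hs.2
    have := hs.1
    positivity
  · rw [integral_beta_zero p r ha, integral_beta_zero p r (ha.trans_le hab)]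
    exact mul_le_mul_of_nonneg_left (Real.rpow_le_rpow ha.le hab (by linarith))
      (betaInt_pos hp hr).le

theorem intervalIntegrable_fracInt {p r C : ℝ} (hp : 0 < p) (hr : 0 < r) {v : ℝ → E} {b : ℝ}
    (hb : 0 ≤ b) (hv : AEStronglyMeasurable v (volume.restrict (Ioo 0 b)))
    (hC : ∀ s ∈ Ioo 0 b, ‖v s‖ ≤ C * s ^ (r - 1)) :
    IntervalIntegrable (fun s => (b - s) ^ (p - 1) • v s) volume 0 b := by
  have h := (intervalIntegrable_iff_integrableOn_Ioo_of_le hb).1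
    ((intervalIntegrable_beta_zero hp hr hb).const_mul C)
  refine (intervalIntegrable_iff_integrableOn_Ioo_of_le hb).2 (h.mono' ?_ ?_)
  · exact AEStronglyMeasurable.smul
      (Measurable.aestronglyMeasurable (by fun_prop)) hv
  · filter_upwards [ae_restrict_mem measurableSet_Ioo] with s hs
    have hbs : 0 ≤ b - s := by linarith [hs.2]
    rw [norm_smul, Real.norm_of_nonneg (by positivity)]
    calc _ ≤ (b - s) ^ (p - 1) * (C * s ^ (r - 1)) :=
          mul_le_mul_of_nonneg_left (hC s hs) (by positivity)
      _ = _ := by ring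

/-- Split at `a`. On `[0, a]` the kernel decreases when `a` is replaced by `b`, since `p ≤ 1`; by
`integral_beta_zero_mono` its total loss there is at most the integral over `[a, b]`. The two pieces
thus obey the same bound, whence the factor 2. -/
theorem norm_fracInt_sub_le {p r C : ℝ} (hp : 0 < p) (hp1 : p ≤ 1) (hr : 0 < r) (hpr : 1 ≤ p + r)
    {v : ℝ → E} {a b : ℝ} (ha : 0 ≤ a) (hab : a ≤ b)
    (hv : AEStronglyMeasurable v (volume.restrict (Ioo 0 b)))
    (hC : ∀ s ∈ Ioo 0 b, ‖v s‖ ≤ C * s ^ (r - 1)) :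
    ‖fracInt p v b - fracInt p v a‖ ≤ 2 * C * ∫ s in a..b, (b - s) ^ (p - 1) * s ^ (r - 1) := by
  have hb : 0 ≤ b := ha.trans hab
  have hib := intervalIntegrable_fracInt hp hr hb hv hC
  have hia := intervalIntegrable_fracInt hp hr ha
    (hv.mono_measure (Measure.restrict_mono (Ioo_subset_Ioo_right hab) le_rfl))
    fun s hs => hC s ⟨hs.1, hs.2.trans_le hab⟩
  have hKb := intervalIntegrable_beta_zero hp hr hb
  have hKa := intervalIntegrable_beta_zero hp hr ha
  have hsub0 : uIcc 0 a ⊆ uIcc 0 b := by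
    rw [uIcc_of_le ha, uIcc_of_le hb]; exact Icc_subset_Icc_right hab
  have hsub1 : uIcc a b ⊆ uIcc 0 b := by
    rw [uIcc_of_le hab, uIcc_of_le hb]; exact Icc_subset_Icc_left ha
  have hib0 := hib.mono_set hsub0
  have hib1 := hib.mono_set hsub1
  have hKb0 := hKb.mono_set hsub0
  have hKb1 := hKb.mono_set hsub1
  have hsplit : fracInt p v b - fracInt p v a =
      (∫ s in (0 : ℝ)..a, ((b - s) ^ (p - 1) • v s - (a - s) ^ (p - 1) • v s)) +
        ∫ s in a..b, (b - s) ^ (p - 1) • v s := by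
    rw [intervalIntegral.integral_sub hib0 hia, fracInt, fracInt,
      ← intervalIntegral.integral_add_adjacent_intervals hib0 hib1]
    abel
  have h0 : ‖∫ s in (0 : ℝ)..a, ((b - s) ^ (p - 1) • v s - (a - s) ^ (p - 1) • v s)‖ ≤
      ∫ s in (0 : ℝ)..a, C * ((a - s) ^ (p - 1) * s ^ (r - 1) - (b - s) ^ (p - 1) * s ^ (r - 1)) := by
    refine intervalIntegral.norm_integral_le_of_norm_le ha ?_ ((hKa.sub hKb0).const_mul C)
    filter_upwards [compl_mem_ae_iff.2 (measure_singleton a)] with s hsa hs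
    have hs' : s < a := lt_of_le_of_ne hs.2 hsa
    have h1 : 0 < a - s := sub_pos.2 hs'
    have h2 : (b - s) ^ (p - 1) ≤ (a - s) ^ (p - 1) :=
      Real.rpow_le_rpow_of_nonpos h1 (by linarith) (by linarith)
    rw [← sub_smul, norm_smul, Real.norm_of_nonpos (by linarith), neg_sub]
    calc _ ≤ ((a - s) ^ (p - 1) - (b - s) ^ (p - 1)) * (C * s ^ (r - 1)) :=
          mul_le_mul_of_nonneg_left (hC s ⟨hs.1, hs'.trans_le hab⟩) (by linarith)
      _ = _ := by ring
  have h1 : ‖∫ s in a..b, (b - s) ^ (p - 1) • v s‖ ≤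
      ∫ s in a..b, C * ((b - s) ^ (p - 1) * s ^ (r - 1)) := by
    refine intervalIntegral.norm_integral_le_of_norm_le hab ?_ (hKb1.const_mul C)
    filter_upwards [compl_mem_ae_iff.2 (measure_singleton b)] with s hsb hs
    have hs' : s < b := lt_of_le_of_ne hs.2 hsb
    have h1 : 0 < b - s := sub_pos.2 hs'
    rw [norm_smul, Real.norm_of_nonneg (by positivity)]
    calc _ ≤ (b - s) ^ (p - 1) * (C * s ^ (r - 1)) :=
          mul_le_mul_of_nonneg_left (hC s ⟨ha.trans_lt hs.1, hs'⟩) (by positivity)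
      _ = _ := by ring
  rw [intervalIntegral.integral_const_mul, intervalIntegral.integral_sub hKa hKb0] at h0
  rw [intervalIntegral.integral_const_mul] at h1
  have hmono := integral_beta_zero_mono hp hr hpr ha hab
  rw [← intervalIntegral.integral_add_adjacent_intervals hKb0 hKb1] at hmono
  rcases hb.eq_or_lt with hb0 | hb0
  · obtain rfl : b = 0 := hb0.symm
    obtain rfl : a = 0 := le_antisymm hab ha
    simp
  have hC0 : 0 ≤ C := by
    have h2 : b / 2 ∈ Ioo 0 b := ⟨by linarith, by linarith⟩
    exact nonneg_of_mul_nonneg_left ((norm_nonneg _).trans (hC _ h2)) (Real.rpow_pos_of_pos h2.1 _)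
  rw [hsplit]
  refine (norm_add_le _ _).trans ?_
  nlinarith [mul_le_mul_of_nonneg_left hmono hC0]

/-- A fractional integral of a function with a weak singularity at `0` is continuous away
from `0`. -/
theorem continuousOn_fracInt_Ioc {p r C : ℝ} (hp : 0 < p) (hp1 : p ≤ 1) (hr : 0 < r) (hr1 : r ≤ 1)
    (hpr : 1 ≤ p + r) {v : ℝ → E} {T : ℝ}
    (hv : AEStronglyMeasurable v (volume.restrict (Ioo 0 T)))
    (hC : ∀ s ∈ Ioo 0 T, ‖v s‖ ≤ C * s ^ (r - 1)) :
    ContinuousOn (fracInt p v) (Ioc 0 T) := by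
  have hloc : ∀ δ, 0 < δ → ContinuousOn (fracInt p v) (Icc δ T) := fun δ hδ => by
    refine continuousOn_of_norm_sub_le_rpow (K := 2 * C * (δ ^ (r - 1) / p)) hp
      fun a ha b hb hab => ?_
    have hb0 : 0 < b := hδ.trans_le hb.1
    have ha0 : 0 < a := hδ.trans_le ha.1
    have hC0 : 0 ≤ C := by
      have h2 : b / 2 ∈ Ioo 0 T := ⟨by linarith, by linarith [hb.2]⟩
      exact nonneg_of_mul_nonneg_left ((norm_nonneg _).trans (hC _ h2))
        (Real.rpow_pos_of_pos h2.1 _)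
    have h := norm_fracInt_sub_le hp hp1 hr hpr ha0.le hab
      (hv.mono_measure (Measure.restrict_mono (Ioo_subset_Ioo_right hb.2) le_rfl))
      fun s hs => hC s ⟨hs.1, hs.2.trans_le hb.2⟩
    refine h.trans ?_
    -- Away from `0` the singular factor is at most `δ ^ (r - 1)`, which leaves a Hölder bound of
    -- order `p`.
    have h1 : ∫ s in a..b, (b - s) ^ (p - 1) * s ^ (r - 1) ≤
        ∫ s in a..b, (b - s) ^ (p - 1) * δ ^ (r - 1) := by
      refine intervalIntegral.integral_mono_on hab ?_
        ((intervalIntegrable_sub_rpow hp _ _ _).mul_const _) fun s hs => ?_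
      · refine (intervalIntegrable_beta_zero hp hr hb0.le).mono_set ?_
        rw [uIcc_of_le hab, uIcc_of_le hb0.le]; exact Icc_subset_Icc_left ha0.le
      · have := sub_nonneg.2 hs.2
        exact mul_le_mul_of_nonneg_left (Real.rpow_le_rpow_of_nonpos hδ (ha.1.trans hs.1)
          (by linarith)) (by positivity)
    rw [intervalIntegral.integral_mul_const, integral_sub_rpow hp, sub_self,
      Real.zero_rpow hp.ne', sub_zero] at h1
    calc _ ≤ 2 * C * ((b - a) ^ p / p * δ ^ (r - 1)) :=
          mul_le_mul_of_nonneg_left h1 (by positivity)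
      _ = _ := by ring
  intro t ht
  have h := hloc (t / 2) (by linarith [ht.1]) t ⟨by linarith [ht.1], ht.2⟩
  refine h.mono_of_mem_nhdsWithin ?_
  filter_upwards [self_mem_nhdsWithin, mem_nhdsWithin_of_mem_nhds
    (Ioi_mem_nhds (show t / 2 < t by linarith [ht.1]))] with s hs hs'
  exact ⟨le_of_lt hs', hs.2⟩

theorem continuousOn_fracInt {p T : ℝ} (hp : 0 < p) (hp1 : p ≤ 1) {v : ℝ → E}
    (hv : ContinuousOn v (Icc 0 T)) : ContinuousOn (fracInt p v) (Icc 0 T) := by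
  obtain ⟨C, hC⟩ := isCompact_Icc.exists_bound_of_continuousOn hv
  refine continuousOn_of_norm_sub_le_rpow (K := 2 * C * (1 / p)) hp fun a ha b hb hab => ?_
  have hsub : Ioo 0 b ⊆ Icc 0 T := fun s hs => ⟨hs.1.le, hs.2.le.trans hb.2⟩
  refine (norm_fracInt_sub_le (r := 1) (C := C) hp hp1 one_pos (by linarith) ha.1 hab
    ((hv.mono hsub).aestronglyMeasurable measurableSet_Ioo)
    fun s hs => by simpa using hC s (hsub hs)).trans (le_of_eq ?_)
  simp only [sub_self, Real.rpow_zero, mul_one]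
  rw [integral_sub_rpow hp, sub_self, Real.zero_rpow hp.ne', sub_zero]
  ring

theorem intervalIntegrable_fracInt_of_continuousOn {p t : ℝ} (hp : 0 < p) (ht : 0 ≤ t)
    {v : ℝ → E} (hv : ContinuousOn v (Icc 0 t)) :
    IntervalIntegrable (fun s => (t - s) ^ (p - 1) • v s) volume 0 t := by
  have h := intervalIntegrable_sub_rpow hp 0 t t
  refine ⟨?_, ?_⟩
  · exact h.1.smul_continuousOn_of_subset hv measurableSet_Ioc isCompact_Icc Ioc_subset_Icc_self
  · simp [Ioc_eq_empty_of_le ht]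

theorem norm_fracInt_le {p t : ℝ} (hp : 0 < p) (ht : 0 ≤ t) {v : ℝ → E} {w : ℝ → ℝ}
    (hw : ContinuousOn w (Icc 0 t)) (h : ∀ s ∈ Icc 0 t, ‖v s‖ ≤ w s) :
    ‖fracInt p v t‖ ≤ fracInt p w t := by
  refine intervalIntegral.norm_integral_le_of_norm_le ht (Eventually.of_forall fun s hs => ?_)
    (intervalIntegrable_fracInt_of_continuousOn hp ht hw)
  have := sub_nonneg.2 hs.2
  rw [norm_smul, Real.norm_of_nonneg (by positivity), smul_eq_mul]
  exact mul_le_mul_of_nonneg_left (h s ⟨hs.1.le, hs.2⟩) (by positivity)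

theorem fracInt_mono {p t : ℝ} (hp : 0 < p) (ht : 0 ≤ t) {v w : ℝ → ℝ}
    (hv : ContinuousOn v (Icc 0 t)) (hw : ContinuousOn w (Icc 0 t))
    (h : ∀ s ∈ Icc 0 t, v s ≤ w s) : fracInt p v t ≤ fracInt p w t := by
  refine intervalIntegral.integral_mono_on ht (intervalIntegrable_fracInt_of_continuousOn hp ht hv)
    (intervalIntegrable_fracInt_of_continuousOn hp ht hw) fun s hs => ?_
  have := sub_nonneg.2 hs.2
  exact mul_le_mul_of_nonneg_left (h s hs) (by positivity)

theorem fracInt_sub {p t : ℝ} (hp : 0 < p) (ht : 0 ≤ t) {v w : ℝ → E}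
    (hv : ContinuousOn v (Icc 0 t)) (hw : ContinuousOn w (Icc 0 t)) :
    fracInt p v t - fracInt p w t = fracInt p (fun s => v s - w s) t := by
  rw [fracInt, fracInt, ← intervalIntegral.integral_sub
    (intervalIntegrable_fracInt_of_continuousOn hp ht hv)
    (intervalIntegrable_fracInt_of_continuousOn hp ht hw)]
  simp only [fracInt, smul_sub]

end Estimates

/-! ### Exponential weights and the fractional Gronwall inequality -/

theorem exp_neg_le_rpow_neg {x a : ℝ} (hx : 0 < x) (ha : 0 ≤ a) (ha1 : a ≤ 1) :
    Real.exp (-x) ≤ x ^ (-a) := by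
  rw [Real.exp_neg, Real.rpow_neg hx.le]
  refine inv_anti₀ (by positivity) ?_
  calc x ^ a ≤ (x + 1) ^ a := Real.rpow_le_rpow hx.le (by linarith) ha
    _ ≤ (x + 1) ^ (1 : ℝ) := Real.rpow_le_rpow_of_exponent_le (by linarith) ha1
    _ ≤ Real.exp x := by simpa using Real.add_one_le_exp x

/-- Since `exp (-l(t-s)) ≤ (l(t-s))^(-q/2)`, half of the order of the kernel is traded for the small
factor `l^(-q/2)`. Monotonicity of `φ s * s^(1-q)` bounds `φ s` by `φ t * t^(1-q) * s^(q-1)`, and a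
convergent beta integral with parameters `q/2` and `q` remains. -/
theorem exists_exp_weight {q T ε : ℝ} (hq : q ∈ Ioo (0 : ℝ) 1) (hε : 0 < ε) :
    ∃ l : ℝ, 0 < l ∧ ∀ t ∈ Icc 0 T, ∀ φ : ℝ → ℝ, ContinuousOn φ (Icc 0 t) →
      (∀ s ∈ Icc 0 t, 0 ≤ φ s) →
      (∀ s, 0 < s → s ≤ t → φ s * s ^ (1 - q) ≤ φ t * t ^ (1 - q)) →
      fracInt q (fun s => Real.exp (l * s) * φ s) t ≤ ε * (Real.exp (l * t) * φ t) := by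
  have hq0 := hq.1
  have hq1 := hq.2
  have hlim : Tendsto (fun l : ℝ => l ^ (-(q / 2)) * (betaInt (q / 2) q * T ^ (q / 2))) atTop
      (𝓝 0) := by
    simpa using (tendsto_rpow_neg_atTop (show 0 < q / 2 by linarith)).mul_const
      (betaInt (q / 2) q * T ^ (q / 2))
  obtain ⟨l, hlε, hl⟩ := ((hlim.eventually_lt_const hε).and (eventually_gt_atTop 0)).exists
  refine ⟨l, hl, fun t ht φ hφ hφ0 hmono => ?_⟩
  have hB := betaInt_pos (show 0 < q / 2 by linarith) hq.1
  have hφt := hφ0 t ⟨ht.1, le_rfl⟩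
  rcases ht.1.eq_or_lt with rfl | ht0
  · simp only [fracInt, intervalIntegral.integral_same]
    positivity
  have hcont : ContinuousOn (fun s => Real.exp (l * s) * φ s) (Icc 0 t) :=
    (Continuous.continuousOn (by fun_prop)).mul hφ
  set D := Real.exp (l * t) * φ t * t ^ (1 - q) * l ^ (-(q / 2)) with hD
  have hle : fracInt q (fun s => Real.exp (l * s) * φ s) t ≤
      ∫ s in (0 : ℝ)..t, D * ((t - s) ^ (q / 2 - 1) * s ^ (q - 1)) := by
    refine intervalIntegral.integral_mono_on_of_le_Ioo ht0.le
      (intervalIntegrable_fracInt_of_continuousOn hq.1 ht0.le hcont)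
      ((intervalIntegrable_beta_zero (by linarith) hq.1 ht0.le).const_mul D) fun s hs => ?_
    have hs0 := hs.1
    have hts : 0 < t - s := by linarith [hs.2]
    have h1 : Real.exp (l * s) ≤ Real.exp (l * t) * (l ^ (-(q / 2)) * (t - s) ^ (-(q / 2))) := by
      have h := exp_neg_le_rpow_neg (mul_pos hl hts) (show 0 ≤ q / 2 by linarith) (by linarith)
      rw [Real.mul_rpow hl.le hts.le] at h
      have h2 : Real.exp (l * s) = Real.exp (l * t) * Real.exp (-(l * (t - s))) := by
        rw [← Real.exp_add]; ring_nf
      rw [h2]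
      exact mul_le_mul_of_nonneg_left h (Real.exp_pos _).le
    have h2 : φ s ≤ φ t * t ^ (1 - q) * s ^ (q - 1) := by
      have h := mul_le_mul_of_nonneg_right (hmono s hs0 hs.2.le) (Real.rpow_nonneg hs0.le (q - 1))
      rwa [mul_assoc, ← Real.rpow_add hs0, show 1 - q + (q - 1) = 0 by ring, Real.rpow_zero,
        mul_one] at h
    have h3 : (t - s) ^ (q / 2 - 1) = (t - s) ^ (q - 1) * (t - s) ^ (-(q / 2)) := by
      rw [← Real.rpow_add hts]; ring_nf
    rw [smul_eq_mul, h3, hD]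
    calc (t - s) ^ (q - 1) * (Real.exp (l * s) * φ s) ≤ (t - s) ^ (q - 1) *
          ((Real.exp (l * t) * (l ^ (-(q / 2)) * (t - s) ^ (-(q / 2)))) *
            (φ t * t ^ (1 - q) * s ^ (q - 1))) := by
          refine mul_le_mul_of_nonneg_left (mul_le_mul h1 h2 (hφ0 s ⟨hs0.le, hs.2.le⟩) ?_) ?_ <;>
            positivity
      _ = _ := by ring
  refine hle.trans ?_
  rw [intervalIntegral.integral_const_mul, integral_beta_zero _ _ ht0, hD]
  have h4 : t ^ (1 - q) * t ^ (q / 2 + q - 1) = t ^ (q / 2) := by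
    rw [← Real.rpow_add ht0]; ring_nf
  have h5 : t ^ (q / 2) ≤ T ^ (q / 2) := Real.rpow_le_rpow ht0.le ht.2 (by linarith)
  calc _ = (l ^ (-(q / 2)) * (betaInt (q / 2) q * (t ^ (1 - q) * t ^ (q / 2 + q - 1)))) *
        (Real.exp (l * t) * φ t) := by ring
    _ ≤ (l ^ (-(q / 2)) * (betaInt (q / 2) q * T ^ (q / 2))) * (Real.exp (l * t) * φ t) := by
        rw [h4]; gcongr
    _ ≤ ε * (Real.exp (l * t) * φ t) := by gcongr

/-- A fractional Gronwall inequality. The constant depends neither on the majorant `φ` nor on the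
length of the interval. -/
theorem exists_fracInt_gronwall {q T L : ℝ} (hq : q ∈ Ioo (0 : ℝ) 1) (hL : 0 ≤ L) :
    ∃ C : ℝ, 0 < C ∧ ∀ b ∈ Icc 0 T, ∀ (A : ℝ) (φ w : ℝ → ℝ), 0 ≤ A → ContinuousOn φ (Icc 0 b) →
      ContinuousOn w (Icc 0 b) → (∀ s ∈ Icc 0 b, 0 < φ s) →
      (∀ s t, 0 < s → s ≤ t → t ≤ b → φ s * s ^ (1 - q) ≤ φ t * t ^ (1 - q)) →
      (∀ t ∈ Icc 0 b, w t ≤ A * φ t + L * fracInt q w t) →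
      ∀ t ∈ Icc 0 b, w t ≤ C * A * φ t := by
  obtain ⟨l, hl, H⟩ := exists_exp_weight (ε := 1 / (2 * (L + 1))) hq (by positivity)
  refine ⟨2 * Real.exp (l * T), by positivity, fun b hb A φ w hA hφ hw hφ0 hmono hle => ?_⟩
  have hcont : ContinuousOn (fun t => w t / (Real.exp (l * t) * φ t)) (Icc 0 b) :=
    hw.div ((Continuous.continuousOn (by fun_prop)).mul hφ)
      fun s hs => (mul_pos (Real.exp_pos _) (hφ0 s hs)).ne'
  -- At a maximum point of the weighted quotient the hypothesis reads `m ≤ A + m / 2` whenever `m ≥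
  -- 0`, because `L / (2 (L + 1)) ≤ 1 / 2`. Hence `m ≤ 2 A`.
  obtain ⟨t₀, ht₀, hmax⟩ := isCompact_Icc.exists_isMaxOn ⟨0, left_mem_Icc.2 hb.1⟩ hcont
  set m := w t₀ / (Real.exp (l * t₀) * φ t₀) with hm
  have hbound : ∀ t ∈ Icc 0 b, w t ≤ m * (Real.exp (l * t) * φ t) := fun t ht =>
    (div_le_iff₀ (mul_pos (Real.exp_pos _) (hφ0 t ht))).1 (hmax ht)
  have hm2 : m ≤ 2 * A := by
    by_contra! hcon
    have hm0 : 0 ≤ m := by linarith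
    have hsub : Icc 0 t₀ ⊆ Icc 0 b := Icc_subset_Icc_right ht₀.2
    have hφc : ContinuousOn (fun s => Real.exp (l * s) * φ s) (Icc 0 t₀) :=
      (Continuous.continuousOn (by fun_prop)).mul (hφ.mono hsub)
    have h1 : fracInt q w t₀ ≤ fracInt q (fun s => m • (Real.exp (l * s) * φ s)) t₀ :=
      fracInt_mono hq.1 ht₀.1 (hw.mono hsub) (hφc.const_smul m) fun s hs => hbound s (hsub hs)
    rw [fracInt_const_smul, smul_eq_mul] at h1
    have h2 := H t₀ ⟨ht₀.1, ht₀.2.trans hb.2⟩ φ (hφ.mono hsub) (fun s hs => (hφ0 s (hsub hs)).le)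
      fun s hs hst => hmono s t₀ hs hst ht₀.2
    have hpos : 0 < Real.exp (l * t₀) * φ t₀ := mul_pos (Real.exp_pos _) (hφ0 t₀ ht₀)
    have h3 : w t₀ = m * (Real.exp (l * t₀) * φ t₀) := (div_mul_cancel₀ _ hpos.ne').symm
    have h4 := hle t₀ ht₀
    have h5 : φ t₀ ≤ Real.exp (l * t₀) * φ t₀ :=
      le_mul_of_one_le_left (hφ0 t₀ ht₀).le (Real.one_le_exp (mul_nonneg hl.le ht₀.1))
    have h6 : L * fracInt q w t₀ ≤ m / 2 * (Real.exp (l * t₀) * φ t₀) := by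
      calc L * fracInt q w t₀ ≤ (L + 1) * (m * (1 / (2 * (L + 1)) * (Real.exp (l * t₀) * φ t₀))) := by
            have h7 := h1.trans (mul_le_mul_of_nonneg_left h2 hm0)
            have h8 : 0 ≤ m * (1 / (2 * (L + 1)) * (Real.exp (l * t₀) * φ t₀)) := by positivity
            nlinarith [mul_le_mul_of_nonneg_left h7 hL]
        _ = _ := by field_simp
    have h9 : A * φ t₀ ≤ A * (Real.exp (l * t₀) * φ t₀) := mul_le_mul_of_nonneg_left h5 hA
    nlinarith
  intro t ht
  calc w t ≤ m * (Real.exp (l * t) * φ t) := hbound t ht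
    _ ≤ 2 * A * (Real.exp (l * T) * φ t) := by
        have h1 : Real.exp (l * t) ≤ Real.exp (l * T) :=
          Real.exp_le_exp.2 (mul_le_mul_of_nonneg_left (ht.2.trans hb.2) hl.le)
        have h2 := hφ0 t ht
        gcongr
    _ = _ := by ring

theorem exists_fracInt_gronwall_const {q T L : ℝ} (hq : q ∈ Ioo (0 : ℝ) 1) (hT : 0 < T)
    (hL : 0 ≤ L) :
    ∃ C : ℝ, 0 < C ∧ ∀ (A : ℝ) (w : ℝ → ℝ), 0 ≤ A → ContinuousOn w (Icc 0 T) →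
      (∀ t ∈ Icc 0 T, w t ≤ A + L * fracInt q w t) → ∀ t ∈ Icc 0 T, w t ≤ C * A := by
  obtain ⟨C, hC, H⟩ := exists_fracInt_gronwall hq hL
  refine ⟨C, hC, fun A w hA hw hle t ht => ?_⟩
  have h := H T ⟨hT.le, le_rfl⟩ A (fun _ => 1) w hA continuousOn_const hw (fun _ _ => one_pos)
    (fun s t hs hst _ => by
      simpa using Real.rpow_le_rpow hs.le hst (by linarith [hq.2])) (by simpa using hle) t ht
  simpa using h

/-! ### Weakly singular Volterra equations -/

section Volterra

variable {E : Type*} [NormedAddCommGroup E] [NormedSpace ℝ E]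

/-- Global existence for Volterra equations with a weakly singular kernel. -/
theorem exists_volterra_solution [CompleteSpace E] {q T c : ℝ} (hq : q ∈ Ioo (0 : ℝ) 1)
    (hT : 0 ≤ T) (hc : 0 ≤ c) {K : ℝ≥0} {F : ℝ → E → E} (hF : Continuous (Function.uncurry F))
    (hK : ∀ t, LipschitzWith K (F t)) (u₀ : E) :
    ∃ u : ℝ → E, ContinuousOn u (Icc 0 T) ∧
      ∀ t ∈ Icc 0 T, u t = u₀ + c • fracInt q (fun s => F s (u s)) t := by
  obtain ⟨l, hl, H⟩ := exists_exp_weight (T := T) (ε := 1 / (2 * (c * K + 1))) hq (by positivity)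
  -- The unknown is `v t = exp (-l t) u t`: the sup metric on `v` is then the weighted metric on
  -- `u`, for which the integral operator halves distances. `projIcc` extends `v` to the line.
  let g : C(Icc 0 T, E) → ℝ → E := fun v s => F s (Real.exp (l * s) • v (projIcc 0 T hT s))
  have hg : ∀ v, Continuous (g v) := fun v => hF.comp (continuous_id.prodMk
    ((by fun_prop : Continuous fun s => Real.exp (l * s)).smul
      (v.continuous.comp continuous_projIcc)))
  let V : C(Icc 0 T, E) → C(Icc 0 T, E) := fun v =>
    ⟨fun t => Real.exp (-(l * t)) • (u₀ + c • fracInt q (g v) t), by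
      have h := continuousOn_iff_continuous_domRestrict.1
        (continuousOn_fracInt hq.1 hq.2.le (hg v).continuousOn (T := T))
      exact Continuous.smul (by fun_prop) (continuous_const.add (h.const_smul c))⟩
  have hV : ContractingWith (1 / 2 : ℝ≥0) V := by
    refine ⟨by norm_num, LipschitzWith.of_dist_le_mul fun v w => ?_⟩
    refine (ContinuousMap.dist_le (by positivity)).2 fun t => ?_
    have ht := t.2
    have hsub : fracInt q (g v) t - fracInt q (g w) t = fracInt q (fun s => g v s - g w s) t :=
      fracInt_sub hq.1 ht.1 (hg v).continuousOn (hg w).continuousOn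
    have hle : ‖fracInt q (fun s => g v s - g w s) t‖ ≤
        fracInt q (fun s => (K * dist v w) • (Real.exp (l * s) * 1)) t := by
      refine norm_fracInt_le hq.1 ht.1 (Continuous.continuousOn (by fun_prop)) fun s _ => ?_
      rw [← dist_eq_norm]
      refine ((hK s).dist_le_mul _ _).trans ?_
      rw [dist_eq_norm, ← smul_sub, norm_smul, Real.norm_of_nonneg (Real.exp_pos _).le,
        ← dist_eq_norm, smul_eq_mul, mul_one, mul_assoc, mul_comm (dist v w)]
      have := ContinuousMap.dist_apply_le_dist (f := v) (g := w) (projIcc 0 T hT s)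
      gcongr
    rw [fracInt_const_smul, smul_eq_mul] at hle
    have hH := H t ht (fun _ => 1) continuousOn_const (fun _ _ => zero_le_one) fun s hs hst => by
      simpa using Real.rpow_le_rpow hs.le hst (by linarith [hq.2])
    rw [dist_eq_norm]
    have heq : V v t - V w t =
        (Real.exp (-(l * t)) * c) • fracInt q (fun s => g v s - g w s) t := by
      simp only [V, ContinuousMap.coe_mk]
      rw [← hsub, ← smul_sub, add_sub_add_left_eq_sub, ← smul_sub, smul_smul]
    rw [heq, norm_smul, Real.norm_of_nonneg (by positivity)]
    have hexp : Real.exp (-(l * t)) * Real.exp (l * t) = 1 := by rw [← Real.exp_add]; simp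
    calc Real.exp (-(l * t)) * c * ‖fracInt q (fun s => g v s - g w s) t‖
        ≤ Real.exp (-(l * t)) * c * (K * dist v w *
          (1 / (2 * (c * K + 1)) * (Real.exp (l * t) * 1))) := by
          refine mul_le_mul_of_nonneg_left (hle.trans ?_) (by positivity)
          exact mul_le_mul_of_nonneg_left hH (by positivity)
      _ = (Real.exp (-(l * t)) * Real.exp (l * t)) * (c * K / (c * K + 1)) *
          (1 / 2 * dist v w) := by field_simp
      _ ≤ 1 * 1 * (1 / 2 * dist v w) := by
          rw [hexp]
          have : c * K / (c * K + 1) ≤ 1 := (div_le_one (by positivity)).2 (by linarith)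
          gcongr
      _ = _ := by simp
  obtain ⟨v, hv⟩ : ∃ v, V v = v := ⟨_, hV.fixedPoint_isFixedPt⟩
  refine ⟨fun s => Real.exp (l * s) • v (projIcc 0 T hT s), Continuous.continuousOn
    ((by fun_prop : Continuous fun s => Real.exp (l * s)).smul
      (v.continuous.comp continuous_projIcc)), fun t ht => ?_⟩
  have h := DFunLike.congr_fun hv (projIcc 0 T hT t)
  have hexp : Real.exp (l * t) * Real.exp (-(l * t)) = 1 := by rw [← Real.exp_add]; simp
  simp only
  rw [← h]
  simp only [V, ContinuousMap.coe_mk, projIcc_of_mem hT ht, smul_smul, hexp, one_smul]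
  rfl

/-- After the shift by `h` the tail has the same kernel as `fracInt p g r`, so increments of a
fractional integral reduce to increments of `g` plus a head integral over `[0, h]`. -/
theorem fracInt_add {p r h : ℝ} (hp : 0 < p) (hr : 0 ≤ r) (hh : 0 ≤ h) {g : ℝ → E}
    (hg : ContinuousOn g (Icc 0 (r + h))) :
    fracInt p g (r + h) =
      (∫ s in (0 : ℝ)..h, (r + h - s) ^ (p - 1) • g s) + fracInt p (fun s => g (s + h)) r := by
  have hi := intervalIntegrable_fracInt_of_continuousOn hp (add_nonneg hr hh) hg
  have hi0 : IntervalIntegrable (fun s => (r + h - s) ^ (p - 1) • g s) volume 0 h := by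
    refine hi.mono_set ?_
    rw [uIcc_of_le hh, uIcc_of_le (add_nonneg hr hh)]
    exact Icc_subset_Icc_right (by linarith)
  have hi1 : IntervalIntegrable (fun s => (r + h - s) ^ (p - 1) • g s) volume h (r + h) := by
    refine hi.mono_set ?_
    rw [uIcc_of_le (by linarith), uIcc_of_le (add_nonneg hr hh)]
    exact Icc_subset_Icc_left hh
  have hshift := intervalIntegral.integral_comp_add_right (a := 0) (b := r)
    (fun s => (r + h - s) ^ (p - 1) • g s) h
  simp only [add_sub_add_right_eq_sub, zero_add] at hshift
  rw [fracInt, fracInt, hshift, intervalIntegral.integral_add_adjacent_intervals hi0 hi1]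

/-- Solutions of weakly singular Volterra equations have the modulus of continuity of `t ^ q`
as functions of `t`, rather than of `t - s`. -/
theorem exists_rpow_modulus {q T c L : ℝ} (hq : q ∈ Ioo (0 : ℝ) 1) (hc : 0 ≤ c) (hL : 0 ≤ L)
    {u g : ℝ → E} {u₀ : E} (hg : ContinuousOn g (Icc 0 T))
    (hu : ∀ t ∈ Icc 0 T, u t = u₀ + c • fracInt q g t)
    (hgu : ∀ s ∈ Icc 0 T, ∀ t ∈ Icc 0 T, s ≤ t →
      ‖g t - g s‖ ≤ L * (‖u t - u s‖ + (t ^ q - s ^ q))) :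
    ∃ C : ℝ, 0 ≤ C ∧ ∀ s ∈ Icc 0 T, ∀ t ∈ Icc 0 T, s ≤ t → ‖u t - u s‖ ≤ C * (t ^ q - s ^ q) := by
  have hq0 := hq.1
  obtain ⟨M', hM'⟩ := isCompact_Icc.exists_bound_of_continuousOn hg
  set M := max M' 0
  have hM : ∀ t ∈ Icc 0 T, ‖g t‖ ≤ M := fun t ht => (hM' t ht).trans (le_max_left _ _)
  have hM0 : 0 ≤ M := le_max_right _ _
  have huc : ContinuousOn u (Icc 0 T) :=
    (continuousOn_const.add ((continuousOn_fracInt hq.1 hq.2.le hg).const_smul c)).congr hu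
  obtain ⟨C, hC, H⟩ := exists_fracInt_gronwall (T := T) hq (mul_nonneg hc hL)
  -- The term `c M / q` comes from the head integral over `[0, h]`, the `1` from the copy of `φ`
  -- added to the unknown below.
  refine ⟨C * (c * M / q + 1), by positivity, fun s hs t ht hst => ?_⟩
  rcases hst.eq_or_lt with rfl | hst
  · simp
  obtain ⟨h, rfl⟩ : ∃ h, t = s + h := ⟨t - s, by ring⟩
  have hh : 0 < h := by linarith
  have hmaps : ∀ r ∈ Icc 0 (T - h), r + h ∈ Icc 0 T := fun r hr =>
    ⟨by linarith [hr.1], by linarith [hr.2]⟩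
  have hsub : Icc 0 (T - h) ⊆ Icc 0 T := Icc_subset_Icc_right (by linarith)
  have hshift : ContinuousOn (fun r : ℝ => r + h) (Icc 0 (T - h)) :=
    Continuous.continuousOn (by fun_prop)
  have hpow : Continuous fun r : ℝ => r ^ q := Real.continuous_rpow_const hq.1.le
  have hφc : ContinuousOn (fun r => (r + h) ^ q - r ^ q) (Icc 0 (T - h)) :=
    ((hpow.comp (by fun_prop : Continuous fun r : ℝ => r + h)).sub hpow).continuousOn
  have hφ0 : ∀ r ∈ Icc 0 (T - h), 0 < (r + h) ^ q - r ^ q := fun r hr =>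
    sub_pos.2 (Real.rpow_lt_rpow hr.1 (by linarith) hq.1)
  -- Adding `φ` to the increment of `u` absorbs the explicit `t ^ q - s ^ q` in the bound on `g`, so
  -- that Gronwall applies to a single function.
  have hwc : ContinuousOn (fun r => ‖u (r + h) - u r‖ + ((r + h) ^ q - r ^ q)) (Icc 0 (T - h)) :=
    ((huc.comp hshift hmaps).sub (huc.mono hsub)).norm.add hφc
  have key := H (T - h) ⟨by linarith [hs.1, ht.2], by linarith⟩ (c * M / q + 1) _ _ (by positivity)
    hφc hwc hφ0 (fun s' t' hs' hst' _ => rpow_add_sub_rpow_mul_le hq hh hs' hst') (fun r hr => ?_)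
    s ⟨hs.1, by linarith [ht.2]⟩
  · exact (le_add_of_nonneg_right (hφ0 s ⟨hs.1, by linarith [ht.2]⟩).le).trans key
  have hsubr : Icc 0 r ⊆ Icc 0 (T - h) := Icc_subset_Icc_right hr.2
  have hrh := hmaps r hr
  have hgh : ContinuousOn (fun x => g (x + h)) (Icc 0 r) := (hg.comp hshift hmaps).mono hsubr
  have hdiff : u (r + h) - u r = c • ((∫ x in (0 : ℝ)..h, (r + h - x) ^ (q - 1) • g x) +
      fracInt q (fun x => g (x + h) - g x) r) := by
    rw [hu _ hrh, hu r (hsub hr), fracInt_add hq.1 hr.1 hh.le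
      (hg.mono (Icc_subset_Icc_right hrh.2)), ← fracInt_sub hq.1 hr.1
      hgh (hg.mono (hsubr.trans hsub)), add_sub_add_left_eq_sub,
      ← smul_sub, add_sub_assoc]
  have h1 : ‖∫ x in (0 : ℝ)..h, (r + h - x) ^ (q - 1) • g x‖ ≤ M * (((r + h) ^ q - r ^ q) / q) := by
    have h2 : ∫ x in (0 : ℝ)..h, M * (r + h - x) ^ (q - 1) = M * (((r + h) ^ q - r ^ q) / q) := by
      rw [intervalIntegral.integral_const_mul, integral_sub_rpow hq.1, sub_zero, add_sub_cancel_right]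
    rw [← h2]
    refine intervalIntegral.norm_integral_le_of_norm_le hh.le (Eventually.of_forall fun x hx => ?_)
      ((intervalIntegrable_sub_rpow hq.1 _ _ _).const_mul M)
    have h3 : 0 ≤ r + h - x := by linarith [hx.2, hr.1]
    rw [norm_smul, Real.norm_of_nonneg (by positivity), mul_comm]
    exact mul_le_mul_of_nonneg_right (hM x ⟨hx.1.le, by linarith [hx.2, hr.1, hrh.2]⟩)
      (by positivity)
  have h4 : ‖fracInt q (fun x => g (x + h) - g x) r‖ ≤
      L * fracInt q (fun x => ‖u (x + h) - u x‖ + ((x + h) ^ q - x ^ q)) r := by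
    rw [← smul_eq_mul, ← fracInt_const_smul]
    refine norm_fracInt_le hq.1 hr.1 ((hwc.mono hsubr).const_smul L) fun x hx => ?_
    exact hgu x (hsub (hsubr hx)) _ (hmaps x (hsubr hx)) (by linarith)
  have h5 : ‖u (r + h) - u r‖ ≤ c * (M * (((r + h) ^ q - r ^ q) / q) +
      L * fracInt q (fun x => ‖u (x + h) - u x‖ + ((x + h) ^ q - x ^ q)) r) := by
    rw [hdiff, norm_smul, Real.norm_of_nonneg hc]
    exact mul_le_mul_of_nonneg_left ((norm_add_le _ _).trans (add_le_add h1 h4)) hc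
  calc _ ≤ _ := add_le_add_left h5 _
    _ = _ := by ring

end Volterra

/-! ### Equivalence of the Caputo problem and the Volterra equation -/

section Caputo

variable {E : Type*} [NormedAddCommGroup E] [NormedSpace ℝ E]

/-- The factor in front of the Volterra integral: `1 / Γ(q)`, written with the beta integral. -/
noncomputable def caputoConst (q : ℝ) : ℝ := Real.Gamma (1 - q) / betaInt q (1 - q)

theorem caputoConst_pos {q : ℝ} (hq : q ∈ Ioo (0 : ℝ) 1) : 0 < caputoConst q :=
  div_pos (Real.Gamma_pos_of_pos (by linarith [hq.2])) (betaInt_pos hq.1 (by linarith [hq.2]))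

theorem caputoDeriv_eq_fracInt (q : ℝ) (u : ℝ → E) (t : ℝ) :
    caputoDeriv q u t = (Real.Gamma (1 - q))⁻¹ • fracInt (1 - q) (deriv u) t := by
  rw [caputoDeriv, fracInt, show 1 - q - 1 = -q by ring]

/-- By concavity of `t ^ q`, `u` is Lipschitz on `(t/2, T)` with constant `C q (t/2)^(q-1)`, which
bounds `deriv u t` whether or not `u` is differentiable at `t`. -/
theorem exists_norm_deriv_le_rpow {q T C : ℝ} (hq : q ∈ Ioo (0 : ℝ) 1) (hC : 0 ≤ C) {u : ℝ → E}
    (hu : ∀ s ∈ Icc 0 T, ∀ t ∈ Icc 0 T, s ≤ t → ‖u t - u s‖ ≤ C * (t ^ q - s ^ q)) :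
    ∃ D, ∀ t ∈ Ioo 0 T, ‖deriv u t‖ ≤ D * t ^ (q - 1) := by
  have hq0 := hq.1
  refine ⟨C * q * (1 / 2) ^ (q - 1), fun t ht => ?_⟩
  have ht0 := ht.1
  have h : ∀ x y : ℝ, t / 2 < x → x ≤ y → y < T →
      ‖u y - u x‖ ≤ C * q * (1 / 2) ^ (q - 1) * t ^ (q - 1) * (y - x) := by
    intro x y hx hxy hy
    have hx0 : 0 < x := by linarith
    have h1 : x ^ (q - 1) ≤ (t * (1 / 2)) ^ (q - 1) :=
      Real.rpow_le_rpow_of_nonpos (by positivity) (by linarith) (by linarith [hq.2])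
    rw [Real.mul_rpow ht0.le (by norm_num)] at h1
    calc _ ≤ C * (y ^ q - x ^ q) := hu x ⟨hx0.le, by linarith⟩ y ⟨by linarith, hy.le⟩ hxy
      _ ≤ C * (q * x ^ (q - 1) * (y - x)) := by
          gcongr
          exact rpow_sub_rpow_le hq hx0 hxy
      _ ≤ C * (q * (t ^ (q - 1) * (1 / 2) ^ (q - 1)) * (y - x)) := by
          have := sub_nonneg.2 hxy
          gcongr
      _ = _ := by ring
  refine norm_deriv_le_of_lip' (by positivity) ?_
  filter_upwards [Ioo_mem_nhds (show t / 2 < t by linarith) ht.2] with x hx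
  rcases le_total t x with htx | hxt
  · rw [Real.norm_of_nonneg (sub_nonneg.2 htx)]
    exact h t x (by linarith) htx hx.2
  · rw [norm_sub_rev, norm_sub_rev x, Real.norm_of_nonneg (sub_nonneg.2 hxt)]
    exact h x t hx.1 hxt ht.2

/-- Left derivatives of the primitives are compared, so that the endpoint `T` is included. -/
theorem eqOn_of_forall_integral_eq [CompleteSpace E] {T : ℝ} {f g : ℝ → E}
    (hf : IntervalIntegrable f volume 0 T) (hg : IntervalIntegrable g volume 0 T)
    (hfc : ContinuousOn f (Ioc 0 T)) (hgc : ContinuousOn g (Ioc 0 T))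
    (h : ∀ t ∈ Icc 0 T, ∫ s in (0 : ℝ)..t, f s = ∫ s in (0 : ℝ)..t, g s) :
    EqOn f g (Ioc 0 T) := by
  intro t ht
  have hT : 0 ≤ T := ht.1.le.trans ht.2
  have hmem : Ioc 0 T ∈ 𝓝[≤] t := by
    filter_upwards [self_mem_nhdsWithin, mem_nhdsWithin_of_mem_nhds (Ioi_mem_nhds ht.1)]
      with s hs hs0 using ⟨hs0, le_trans hs ht.2⟩
  have hsub : uIcc 0 t ⊆ uIcc 0 T := by
    rw [uIcc_of_le ht.1.le, uIcc_of_le hT]; exact Icc_subset_Icc_right ht.2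
  have key : ∀ f : ℝ → E, IntervalIntegrable f volume 0 T → ContinuousOn f (Ioc 0 T) →
      HasDerivWithinAt (fun x => ∫ s in (0 : ℝ)..x, f s) (f t) (Iic t) t := fun f hf hfc =>
    intervalIntegral.integral_hasDerivWithinAt_right (hf.mono_set hsub)
      ⟨Ioc 0 T, hmem, hfc.aestronglyMeasurable measurableSet_Ioc⟩
      ((hfc t ht).mono_of_mem_nhdsWithin hmem)
  refine (uniqueDiffWithinAt_Iic t).eq_deriv _ (key f hf hfc)
    ((key g hg hgc).congr_of_eventuallyEq ?_ (h t ⟨ht.1.le, ht.2⟩))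
  filter_upwards [hmem] with s hs using h s ⟨hs.1.le, hs.2⟩

variable [FiniteDimensional ℝ E]

/-- A solution of a Caputo initial value problem solves the Volterra integral equation. -/
theorem IsCaputoSolution.eq_add_fracInt {q T : ℝ} (hq : q ∈ Ioo (0 : ℝ) 1) {F : ℝ → E → E}
    {u₀ : E} {u : ℝ → E} (h : IsCaputoSolution q T F u₀ u) {t : ℝ} (ht : t ∈ Icc 0 T) :
    u t = u₀ + caputoConst q • fracInt q (fun s => F s (u s)) t := by
  have := FiniteDimensional.complete ℝ E
  have hac : AbsolutelyContinuousOnInterval u 0 t := h.absolutelyContinuous.mono (by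
    rw [uIcc_of_le ht.1, uIcc_of_le (ht.1.trans ht.2)]
    exact Icc_subset_Icc_right ht.2)
  have h1 : fracInt q (fun s => F s (u s)) t =
      fracInt q (fun s => (Real.Gamma (1 - q))⁻¹ • fracInt (1 - q) (deriv u) s) t :=
    fracInt_congr ht.1 fun s hs => by
      rw [← caputoDeriv_eq_fracInt, h.equation s ⟨hs.1, hs.2.trans ht.2⟩]
  have hΓ : Real.Gamma (1 - q) ≠ 0 := (Real.Gamma_pos_of_pos (by linarith [hq.2])).ne'
  have hB : betaInt q (1 - q) ≠ 0 := (betaInt_pos hq.1 (by linarith [hq.2])).ne'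
  rw [h1, fracInt_const_smul, fracInt_fracInt (by linarith [hq.2]) hq.1 (by linarith) ht.1
    hac.intervalIntegrable_deriv_of_finiteDimensional, add_sub_cancel, fracInt_one,
    hac.integral_deriv_eq_sub_of_finiteDimensional, h.initial, smul_smul, smul_smul, caputoConst]
  have : Real.Gamma (1 - q) / betaInt q (1 - q) * (Real.Gamma (1 - q))⁻¹ * betaInt q (1 - q) = 1 := by
    field_simp
  rw [this, one_smul, add_sub_cancel]

/-- A solution of the Volterra integral equation with the modulus of continuity of `t ^ q` solves
the Caputo initial value problem. -/
theorem isCaputoSolution_of_eq_add_fracInt {q T C : ℝ} (hq : q ∈ Ioo (0 : ℝ) 1) (hT : 0 < T)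
    (hC : 0 ≤ C) {F : ℝ → E → E} {u₀ : E} {u : ℝ → E}
    (hg : ContinuousOn (fun s => F s (u s)) (Icc 0 T))
    (hu : ∀ t ∈ Icc 0 T, u t = u₀ + caputoConst q • fracInt q (fun s => F s (u s)) t)
    (hmod : ∀ s ∈ Icc 0 T, ∀ t ∈ Icc 0 T, s ≤ t → ‖u t - u s‖ ≤ C * (t ^ q - s ^ q)) :
    IsCaputoSolution q T F u₀ u := by
  have := FiniteDimensional.complete ℝ E
  have hq0 := hq.1
  have hq1 : 0 < 1 - q := by linarith [hq.2]
  have hinit : u 0 = u₀ := by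
    rw [hu 0 ⟨le_rfl, hT.le⟩, fracInt, intervalIntegral.integral_same, smul_zero, add_zero]
  have hac : AbsolutelyContinuousOnInterval u 0 T := by
    refine ((absolutelyContinuousOnInterval_rpow hq.1 0 T).const_mul C).of_dist_le ?_
    rw [uIcc_of_le hT.le]
    have h : ∀ s ∈ Icc 0 T, ∀ t ∈ Icc 0 T, s ≤ t →
        dist (u t) (u s) ≤ dist (C * t ^ q) (C * s ^ q) := fun s hs t ht hst => by
      rw [dist_eq_norm, Real.dist_eq, ← mul_sub]
      exact (hmod s hs t ht hst).trans (le_abs_self _)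
    intro s hs t ht
    rcases le_total s t with hst | hts
    · rw [dist_comm, dist_comm (C * s ^ q)]
      exact h s hs t ht hst
    · exact h t ht s hs hts
  obtain ⟨D, hD⟩ := exists_norm_deriv_le_rpow hq hC hmod
  have hmeas : ∀ t, AEStronglyMeasurable (deriv u) (volume.restrict (Ioo 0 t)) := fun t =>
    aestronglyMeasurable_deriv u _
  have hint : ∀ t ∈ Ioc 0 T,
      IntervalIntegrable (fun s => (t - s) ^ (1 - q - 1) • deriv u s) volume 0 t := fun t ht =>
    intervalIntegrable_fracInt hq1 hq.1 ht.1.le (hmeas t)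
      fun s hs => hD s ⟨hs.1, hs.2.trans_le ht.2⟩
  have hexp : 1 - q - 1 = -q := by ring
  refine ⟨hinit, hac, fun t ht => by simpa only [hexp] using hint t ht, fun t ht => ?_⟩
  have hcont : ContinuousOn (fracInt (1 - q) (deriv u)) (Ioc 0 T) :=
    continuousOn_fracInt_Ioc hq1 (by linarith) hq.1 hq.2.le (by linarith) (hmeas T) hD
  have hbound : ∀ s ∈ Ioc 0 T, ‖fracInt (1 - q) (deriv u) s‖ ≤ D * betaInt (1 - q) q := by
    intro s hs
    have h1 : ∫ r in (0 : ℝ)..s, D * ((s - r) ^ (1 - q - 1) * r ^ (q - 1)) =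
        D * betaInt (1 - q) q := by
      rw [intervalIntegral.integral_const_mul, integral_beta_zero _ _ hs.1]
      simp
    rw [← h1]
    refine intervalIntegral.norm_integral_le_of_norm_le hs.1.le ?_
      ((intervalIntegrable_beta_zero hq1 hq.1 hs.1.le).const_mul D)
    filter_upwards [compl_mem_ae_iff.2 (measure_singleton s)] with r hrs hr
    have hr' : r < s := lt_of_le_of_ne hr.2 hrs
    have h2 : 0 < s - r := sub_pos.2 hr'
    rw [norm_smul, Real.norm_of_nonneg (by positivity)]
    calc _ ≤ (s - r) ^ (1 - q - 1) * (D * r ^ (q - 1)) :=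
          mul_le_mul_of_nonneg_left (hD r ⟨hr.1, hr'.trans_le hs.2⟩) (by positivity)
      _ = _ := by ring
  have hI : IntervalIntegrable (fracInt (1 - q) (deriv u)) volume 0 T := by
    rw [intervalIntegrable_iff_integrableOn_Ioc_of_le hT.le]
    refine Integrable.mono' (g := fun _ => D * betaInt (1 - q) q) (integrable_const _)
      (hcont.aestronglyMeasurable measurableSet_Ioc) ?_
    filter_upwards [ae_restrict_mem measurableSet_Ioc] with s hs using hbound s hs
  have hgI : IntervalIntegrable (fun s => F s (u s)) volume 0 T :=
    hg.intervalIntegrable_of_Icc hT.le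
  have hmono : ∀ {t}, t ∈ Icc 0 T → uIcc 0 t ⊆ uIcc 0 T := fun {t} ht => by
    rw [uIcc_of_le ht.1, uIcc_of_le hT.le]; exact Icc_subset_Icc_right ht.2
  have hΓ : 0 < Real.Gamma (1 - q) := Real.Gamma_pos_of_pos hq1
  have hprim : ∀ s ∈ Icc 0 T, fracInt 1 (deriv u) s =
      caputoConst q • fracInt q (fun s => F s (u s)) s := fun s hs => by
    rw [fracInt_one, (hac.mono (hmono hs)).integral_deriv_eq_sub_of_finiteDimensional, hinit,
      hu s hs, add_sub_cancel_left]
  -- Commute `I^1` past `I^(1-q)`, insert the Volterra equation for `I^1 u'`, and recombine `I^(1-q)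
  -- I^q` into a multiple of `I^1`. The constants collapse because `caputoConst q * betaInt q (1 -
  -- q) = Γ(1 - q)`.
  have heq : ∀ s ∈ Icc 0 T, ∫ r in (0 : ℝ)..s, fracInt (1 - q) (deriv u) r =
      ∫ r in (0 : ℝ)..s, Real.Gamma (1 - q) • F r (u r) := fun s hs => by
    have hd := (hac.mono (hmono hs)).intervalIntegrable_deriv_of_finiteDimensional
    rw [← fracInt_one, fracInt_fracInt hq1 one_pos (by linarith) hs.1 hd, betaInt_comm,
      add_comm 1 (1 - q), ← fracInt_fracInt one_pos hq1 (by linarith) hs.1 hd,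
      fracInt_congr hs.1 fun r hr => hprim r ⟨hr.1.le, hr.2.trans hs.2⟩, fracInt_const_smul,
      fracInt_fracInt hq.1 hq1 (by linarith) hs.1 (hgI.mono_set (hmono hs)), sub_add_cancel,
      fracInt_one, intervalIntegral.integral_smul, smul_smul, caputoConst, betaInt_comm (1 - q) q,
      div_mul_cancel₀ _ (betaInt_pos hq.1 hq1).ne']
  have hfin := eqOn_of_forall_integral_eq hI (hgI.smul (Real.Gamma (1 - q))) hcont
    ((hg.mono Ioc_subset_Icc_self).const_smul _) heq ht
  rw [caputoDeriv_eq_fracInt, hfin]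
  simp only [Pi.smul_apply]
  rw [inv_smul_smul₀ hΓ.ne']

end Caputo

/-! ### Cut-off and Taylor remainder -/

section Truncation

variable {E : Type*} [NormedAddCommGroup E] [NormedSpace ℝ E]

/-- A `C²` map agrees on a given ball with a `C²` map that is Lipschitz with Lipschitz
derivative. -/
theorem exists_lipschitz_truncation [FiniteDimensional ℝ E] {f : E → E} (hf : ContDiff ℝ 2 f)
    (R : ℝ) :
    ∃ (g : E → E) (K M : ℝ≥0), ContDiff ℝ 2 g ∧ LipschitzWith K g ∧
      LipschitzWith M (fderiv ℝ g) ∧ ∀ x, ‖x‖ < R → g x = f x ∧ fderiv ℝ g x = fderiv ℝ f x := by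
  let χ : ContDiffBump (0 : E) := ⟨|R| + 1, |R| + 2, by positivity, by linarith⟩
  have hg : ContDiff ℝ 2 fun x => χ x • f x := χ.contDiff.smul hf
  have hcs : HasCompactSupport fun x => χ x • f x := χ.hasCompactSupport.smul_right
  obtain ⟨K, hK⟩ := hg.lipschitzWith_of_hasCompactSupport hcs (by norm_num)
  have hg' : ContDiff ℝ 1 (fderiv ℝ fun x => χ x • f x) := hg.fderiv_right (by norm_num)
  obtain ⟨M, hM⟩ := hg'.lipschitzWith_of_hasCompactSupport (hcs.fderiv ℝ) (by norm_num)
  have heq : ∀ x, ‖x‖ < R → χ x • f x = f x := fun x hx => by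
    rw [χ.one_of_mem_closedBall, one_smul]
    rw [mem_closedBall_zero_iff]
    exact hx.le.trans ((le_abs_self R).trans (by simp [χ]))
  refine ⟨_, K, M, hg, hK, hM, fun x hx => ⟨heq x hx, Filter.EventuallyEq.fderiv_eq ?_⟩⟩
  filter_upwards [(isOpen_lt continuous_norm continuous_const).mem_nhds hx] with z hz using heq z hz

/-- Mean value inequality on the ball of radius `‖a - b‖` about `b`, where the derivative differs
from `fderiv ℝ g b` by at most `M ‖a - b‖`. -/
theorem norm_sub_sub_fderiv_le {g : E → E} {M : ℝ≥0} (hg : Differentiable ℝ g)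
    (hM : LipschitzWith M (fderiv ℝ g)) (a b : E) :
    ‖g a - g b - fderiv ℝ g b (a - b)‖ ≤ M * ‖a - b‖ ^ 2 := by
  have h := (convex_closedBall b ‖a - b‖).norm_image_sub_le_of_norm_hasFDerivWithin_le'
    (f := g) (f' := fderiv ℝ g) (φ := fderiv ℝ g b) (C := M * ‖a - b‖) (x := b) (y := a)
    (fun z _ => (hg z).hasFDerivAt.hasFDerivWithinAt) (fun z hz => ?_)
    (Metric.mem_closedBall_self (norm_nonneg _)) (by simp [dist_eq_norm])
  · refine h.trans (le_of_eq (by ring))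
  · rw [← dist_eq_norm]
    exact (hM.dist_le_mul _ _).trans (mul_le_mul_of_nonneg_left (Metric.mem_closedBall.1 hz) M.2)

end Truncation

/-! ### Stability, existence and first-order expansion of solutions -/

section Solutions

variable {E : Type*} [NormedAddCommGroup E] [NormedSpace ℝ E]

/-- One estimate with three uses: uniqueness (`a = 0`, `δ = 0`), Lipschitz dependence on the initial
value (`δ = 0`), and the first-order expansion (`a = 0`, `δ` quadratic). -/
theorem exists_volterra_stability {q T c K : ℝ} (hq : q ∈ Ioo (0 : ℝ) 1) (hT : 0 < T)
    (hc : 0 ≤ c) (hK : 0 ≤ K) :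
    ∃ C : ℝ, 0 < C ∧ ∀ (a : E) (d w : ℝ → E) (δ : ℝ), 0 ≤ δ → ContinuousOn d (Icc 0 T) →
      (∀ t ∈ Icc 0 T, w t = a + c • fracInt q d t) → (∀ t ∈ Icc 0 T, ‖d t‖ ≤ K * ‖w t‖ + δ) →
      ∀ t ∈ Icc 0 T, ‖w t‖ ≤ C * (‖a‖ + δ) := by
  have hq0 := hq.1
  obtain ⟨C, hC, H⟩ := exists_fracInt_gronwall_const hq hT (mul_nonneg hc hK)
  refine ⟨C * (1 + c * (T ^ q / q)), by positivity, fun a d w δ hδ hd hw hdw t ht => ?_⟩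
  have hwc : ContinuousOn w (Icc 0 T) :=
    (continuousOn_const.add ((continuousOn_fracInt hq.1 hq.2.le hd).const_smul c)).congr hw
  have h := H (‖a‖ + c * (δ * (T ^ q / q))) (fun t => ‖w t‖) (by positivity) hwc.norm
    (fun t ht => ?_) t ht
  · refine h.trans ?_
    rw [mul_assoc]
    refine mul_le_mul_of_nonneg_left ?_ hC.le
    have h1 : 0 ≤ c * (T ^ q / q) * ‖a‖ := by positivity
    nlinarith
  have hsub : Icc 0 t ⊆ Icc 0 T := Icc_subset_Icc_right ht.2
  have hwt := hwc.norm.mono hsub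
  have h1 : ‖fracInt q d t‖ ≤ K * fracInt q (fun t => ‖w t‖) t + δ * (T ^ q / q) := by
    have h2 : ‖fracInt q d t‖ ≤ fracInt q (fun s => K * ‖w s‖ + δ) t :=
      norm_fracInt_le hq.1 ht.1 ((continuousOn_const.mul hwt).add continuousOn_const)
        fun s hs => hdw s (hsub hs)
    have h3 : fracInt q (fun s => K * ‖w s‖ + δ) t - fracInt q (fun s => K • ‖w s‖) t =
        fracInt q (fun _ => δ) t := by
      rw [fracInt_sub hq.1 ht.1 (v := fun s => K * ‖w s‖ + δ) (w := fun s => K • ‖w s‖)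
        ((continuousOn_const.mul hwt).add continuousOn_const) (hwt.const_smul K)]
      simp
    have h4 : fracInt q (fun _ => δ) t = δ * (t ^ q / q) := by
      simp only [fracInt, smul_eq_mul]
      rw [intervalIntegral.integral_mul_const, integral_sub_rpow hq.1, sub_self, sub_zero,
        Real.zero_rpow hq.1.ne', sub_zero, mul_comm]
    have h5 : δ * (t ^ q / q) ≤ δ * (T ^ q / q) := by
      have := Real.rpow_le_rpow ht.1 ht.2 hq.1.le
      gcongr
    rw [fracInt_const_smul, smul_eq_mul] at h3
    linarith
  calc ‖w t‖ ≤ ‖a‖ + ‖c • fracInt q d t‖ := by rw [hw t ht]; exact norm_add_le _ _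
    _ ≤ ‖a‖ + c * (K * fracInt q (fun t => ‖w t‖) t + δ * (T ^ q / q)) := by
        rw [norm_smul, Real.norm_of_nonneg hc]; gcongr
    _ = _ := by ring

theorem fracInt_clm_apply {F : Type*} [NormedAddCommGroup F] [NormedSpace ℝ F] [CompleteSpace E]
    [CompleteSpace F] (L : E →L[ℝ] F) {p t : ℝ} (hp : 0 < p) (ht : 0 ≤ t) {v : ℝ → E}
    (hv : ContinuousOn v (Icc 0 t)) : L (fracInt p v t) = fracInt p (fun s => L (v s)) t := by
  rw [fracInt, ← L.intervalIntegral_comp_comm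
    (intervalIntegrable_fracInt_of_continuousOn hp ht hv)]
  simp [fracInt]

theorem IsCaputoSolution.continuousOn {q T : ℝ} (hT : 0 ≤ T) {F : ℝ → E → E} {u₀ : E} {u : ℝ → E}
    (h : IsCaputoSolution q T F u₀ u) : ContinuousOn u (Icc 0 T) := by
  simpa [uIcc_of_le hT] using h.absolutelyContinuous.continuousOn

theorem IsCaputoSolution.congr {q T : ℝ} {F G : ℝ → E → E} {u₀ : E} {u : ℝ → E}
    (h : IsCaputoSolution q T F u₀ u) (hFG : ∀ t ∈ Icc 0 T, F t (u t) = G t (u t)) :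
    IsCaputoSolution q T G u₀ u :=
  ⟨h.initial, h.absolutelyContinuous, h.integrable,
    fun t ht => (h.equation t ht).trans (hFG t ⟨ht.1.le, ht.2⟩)⟩

theorem IsCaputoSolution.exists_norm_lt {q T : ℝ} (hT : 0 ≤ T) {F : ℝ → E → E} {y : E}
    {u : ℝ → E} (hu : IsCaputoSolution q T F y u) : ∃ R, ∀ t ∈ Icc 0 T, ‖u t‖ < R := by
  obtain ⟨R, hR⟩ := isCompact_Icc.exists_bound_of_continuousOn (hu.continuousOn hT)
  exact ⟨R + 1, fun t ht => (hR t ht).trans_lt (lt_add_one R)⟩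

variable [FiniteDimensional ℝ E]

/-- The Lipschitz bound is required only along the two solutions, so it is available for a merely
locally Lipschitz right-hand side. -/
theorem IsCaputoSolution.eqOn {q T K : ℝ} (hq : q ∈ Ioo (0 : ℝ) 1) (hT : 0 < T) (hK : 0 ≤ K)
    {F : ℝ → E → E} {u₀ : E} {u v : ℝ → E} (hu : IsCaputoSolution q T F u₀ u)
    (hv : IsCaputoSolution q T F u₀ v) (hFu : ContinuousOn (fun t => F t (u t)) (Icc 0 T))
    (hFv : ContinuousOn (fun t => F t (v t)) (Icc 0 T))
    (hF : ∀ t ∈ Icc 0 T, ‖F t (u t) - F t (v t)‖ ≤ K * ‖u t - v t‖) : EqOn u v (Icc 0 T) := by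
  obtain ⟨C, -, H⟩ := exists_volterra_stability (E := E) hq hT (caputoConst_pos hq).le hK
  intro t ht
  have h := H 0 (fun s => F s (u s) - F s (v s)) (fun s => u s - v s) 0 le_rfl (hFu.sub hFv)
    (fun s hs => ?_) (fun s hs => by simpa using hF s hs) t ht
  · simpa [sub_eq_zero] using h
  have hsub : Icc 0 s ⊆ Icc 0 T := Icc_subset_Icc_right hs.2
  rw [hu.eq_add_fracInt hq hs, hv.eq_add_fracInt hq hs,
    ← fracInt_sub hq.1 hs.1 (hFu.mono hsub) (hFv.mono hsub), smul_sub]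
  abel

/-- A Caputo initial value problem with Lipschitz right-hand side has a solution. -/
theorem exists_isCaputoSolution {q T : ℝ} (hq : q ∈ Ioo (0 : ℝ) 1) (hT : 0 < T) {K : ℝ≥0}
    {f : E → E} (hf : LipschitzWith K f) (y : E) :
    ∃ u : ℝ → E, IsCaputoSolution q T (fun _ => f) y u := by
  have := FiniteDimensional.complete ℝ E
  obtain ⟨u, huc, hu⟩ := exists_volterra_solution (F := fun _ => f) hq hT.le
    (caputoConst_pos hq).le (hf.continuous.comp continuous_snd) (fun _ => hf) y
  have hg : ContinuousOn (fun s => f (u s)) (Icc 0 T) := hf.continuous.comp_continuousOn huc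
  obtain ⟨C, hC, hmod⟩ := exists_rpow_modulus hq (caputoConst_pos hq).le K.2 hg hu
    fun s hs t ht hst => by
      rw [← dist_eq_norm, ← dist_eq_norm]
      refine (hf.dist_le_mul _ _).trans (mul_le_mul_of_nonneg_left ?_ K.2)
      linarith [Real.rpow_le_rpow hs.1 hst hq.1.le]
  exact ⟨u, isCaputoSolution_of_eq_add_fracInt hq hT hC hg hu hmod⟩

theorem IsCaputoSolution.exists_rpow_modulus {q T : ℝ} (hq : q ∈ Ioo (0 : ℝ) 1) (hT : 0 < T)
    {K : ℝ≥0} {f : E → E} (hf : LipschitzWith K f) {y : E} {u : ℝ → E}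
    (hu : IsCaputoSolution q T (fun _ => f) y u) :
    ∃ C : ℝ, 0 ≤ C ∧ ∀ s ∈ Icc 0 T, ∀ t ∈ Icc 0 T, s ≤ t → ‖u t - u s‖ ≤ C * (t ^ q - s ^ q) :=
  _root_.exists_rpow_modulus hq (caputoConst_pos hq).le K.2
    (hf.continuous.comp_continuousOn (hu.continuousOn hT.le)) (fun t ht => hu.eq_add_fracInt hq ht)
    fun s hs t ht hst => by
      rw [← dist_eq_norm, ← dist_eq_norm]
      refine (hf.dist_le_mul _ _).trans (mul_le_mul_of_nonneg_left ?_ K.2)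
      linarith [Real.rpow_le_rpow hs.1 hst hq.1.le]

/-- Solutions of an autonomous Caputo initial value problem are unique. -/
theorem IsCaputoSolution.eqOn_of_contDiff {q T : ℝ} (hq : q ∈ Ioo (0 : ℝ) 1) (hT : 0 < T)
    {f : E → E} (hf : ContDiff ℝ 2 f) {y : E} {u v : ℝ → E}
    (hu : IsCaputoSolution q T (fun _ => f) y u) (hv : IsCaputoSolution q T (fun _ => f) y v) :
    EqOn u v (Icc 0 T) := by
  obtain ⟨R, hR⟩ := hu.exists_norm_lt hT.le
  obtain ⟨S, hS⟩ := hv.exists_norm_lt hT.le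
  obtain ⟨g, K, -, -, hK, -, hgf⟩ := exists_lipschitz_truncation hf (max R S)
  refine hu.eqOn hq hT K.2 hv (hf.continuous.comp_continuousOn (hu.continuousOn hT.le))
    (hf.continuous.comp_continuousOn (hv.continuousOn hT.le)) fun t ht => ?_
  rw [← (hgf _ ((hR t ht).trans_le (le_max_left R S))).1,
    ← (hgf _ ((hS t ht).trans_le (le_max_right R S))).1, ← dist_eq_norm, ← dist_eq_norm]
  exact hK.dist_le_mul _ _

/-- The variational system along a solution has a solution. -/
theorem exists_isCaputoSolution_variational {q T : ℝ} (hq : q ∈ Ioo (0 : ℝ) 1) (hT : 0 < T)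
    {K M : ℝ≥0} {g : E → E} (hg : LipschitzWith K g) (hg' : LipschitzWith M (fderiv ℝ g))
    {x₀ : E} {x : ℝ → E} (hx : IsCaputoSolution q T (fun _ => g) x₀ x) :
    ∃ Φ : ℝ → (E →L[ℝ] E), IsCaputoSolution q T (fun t N => (fderiv ℝ g (x t)).comp N)
      (ContinuousLinearMap.id ℝ E) Φ := by
  have := FiniteDimensional.complete ℝ E
  have hxc := hx.continuousOn hT.le
  -- The coefficient is frozen outside `[0, T]` because the existence theorem wants it continuous on
  -- the whole line.
  have hA : Continuous fun t => fderiv ℝ g (x (projIcc 0 T hT.le t)) :=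
    hg'.continuous.comp (hxc.domRestrict.comp continuous_projIcc)
  have hnorm : ∀ z, ‖fderiv ℝ g z‖ ≤ K := fun z => norm_fderiv_le_of_lipschitz ℝ hg
  obtain ⟨Φ, hΦc, hΦ⟩ := exists_volterra_solution (K := K)
    (F := fun t (N : E →L[ℝ] E) => (fderiv ℝ g (x (projIcc 0 T hT.le t))).comp N) hq hT.le
    (caputoConst_pos hq).le ((hA.comp continuous_fst).clm_comp continuous_snd)
    (fun t => LipschitzWith.of_dist_le_mul fun N N' => by
      rw [dist_eq_norm, dist_eq_norm, ← ContinuousLinearMap.comp_sub]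
      exact (ContinuousLinearMap.opNorm_comp_le _ _).trans
        (mul_le_mul_of_nonneg_right (hnorm _) (norm_nonneg _)))
    (ContinuousLinearMap.id ℝ E)
  obtain ⟨C, hC, hmod⟩ := hx.exists_rpow_modulus hq hT hg
  obtain ⟨B', hB'⟩ := isCompact_Icc.exists_bound_of_continuousOn hΦc
  set B := max B' 0
  have hB0 : 0 ≤ B := le_max_right _ _
  have hB : ∀ t ∈ Icc 0 T, ‖Φ t‖ ≤ B := fun t ht => (hB' t ht).trans (le_max_left _ _)
  have hGc : ContinuousOn (fun t => (fderiv ℝ g (x (projIcc 0 T hT.le t))).comp (Φ t)) (Icc 0 T) :=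
    hA.continuousOn.clm_comp hΦc
  -- Product rule for increments: `K` multiplies the increment of `Φ`, while `M * C * B` bounds the
  -- change of the coefficient along `x` times `‖Φ‖`. The latter is why the modulus lemma admits a
  -- `t ^ q - s ^ q` term.
  obtain ⟨C', hC', hmod'⟩ := exists_rpow_modulus (L := K + M * C * B) hq (caputoConst_pos hq).le
    (by positivity) hGc hΦ fun s hs t ht hst => by
      simp only [projIcc_of_mem hT.le hs, projIcc_of_mem hT.le ht]
      have h1 : (fderiv ℝ g (x t)).comp (Φ t) - (fderiv ℝ g (x s)).comp (Φ s) =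
          (fderiv ℝ g (x t)).comp (Φ t - Φ s) + (fderiv ℝ g (x t) - fderiv ℝ g (x s)).comp (Φ s) := by
        rw [ContinuousLinearMap.comp_sub, ContinuousLinearMap.sub_comp]
        abel
      have h2 : ‖fderiv ℝ g (x t) - fderiv ℝ g (x s)‖ ≤ M * (C * (t ^ q - s ^ q)) := by
        rw [← dist_eq_norm]
        refine (hg'.dist_le_mul _ _).trans (mul_le_mul_of_nonneg_left ?_ M.2)
        rw [dist_eq_norm]
        exact hmod s hs t ht hst
      have h3 : 0 ≤ t ^ q - s ^ q := sub_nonneg.2 (Real.rpow_le_rpow hs.1 hst hq.1.le)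
      rw [h1]
      calc _ ≤ K * ‖Φ t - Φ s‖ + (M * (C * (t ^ q - s ^ q))) * B := by
            refine (norm_add_le _ _).trans (add_le_add ?_ ?_)
            · exact (ContinuousLinearMap.opNorm_comp_le _ _).trans
                (mul_le_mul_of_nonneg_right (hnorm _) (norm_nonneg _))
            · exact (ContinuousLinearMap.opNorm_comp_le _ _).trans
                (mul_le_mul h2 (hB s hs) (norm_nonneg _) (by positivity))
        _ ≤ _ := by
            have h4 : 0 ≤ K * (t ^ q - s ^ q) := by positivity
            have h5 : 0 ≤ M * C * B * ‖Φ t - Φ s‖ := by positivity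
            nlinarith
  refine ⟨Φ, (isCaputoSolution_of_eq_add_fracInt hq hT hC' hGc hΦ hmod').congr fun t ht => ?_⟩
  simp only [projIcc_of_mem hT.le ht]

theorem exists_norm_sub_le {q T : ℝ} (hq : q ∈ Ioo (0 : ℝ) 1) (hT : 0 < T) {K : ℝ≥0} {g : E → E}
    (hg : LipschitzWith K g) :
    ∃ C : ℝ, 0 < C ∧ ∀ (y z : E) (u v : ℝ → E), IsCaputoSolution q T (fun _ => g) y u →
      IsCaputoSolution q T (fun _ => g) z v → ∀ t ∈ Icc 0 T, ‖u t - v t‖ ≤ C * ‖y - z‖ := by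
  obtain ⟨C, hC, H⟩ := exists_volterra_stability (E := E) hq hT (caputoConst_pos hq).le K.2
  refine ⟨C, hC, fun y z u v hu hv t ht => ?_⟩
  have hgu : ContinuousOn (fun s => g (u s)) (Icc 0 T) :=
    hg.continuous.comp_continuousOn (hu.continuousOn hT.le)
  have hgv : ContinuousOn (fun s => g (v s)) (Icc 0 T) :=
    hg.continuous.comp_continuousOn (hv.continuousOn hT.le)
  have h := H (y - z) (fun s => g (u s) - g (v s)) (fun s => u s - v s) 0 le_rfl (hgu.sub hgv)
    (fun s hs => ?_) (fun s _ => ?_) t ht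
  · simpa using h
  · have hsub : Icc 0 s ⊆ Icc 0 T := Icc_subset_Icc_right hs.2
    rw [hu.eq_add_fracInt hq hs, hv.eq_add_fracInt hq hs,
      ← fracInt_sub hq.1 hs.1 (hgu.mono hsub) (hgv.mono hsub), smul_sub]
    abel
  · rw [add_zero, ← dist_eq_norm, ← dist_eq_norm]
    exact hg.dist_le_mul _ _

/-- First-order expansion of the solution in the initial value. -/
theorem exists_norm_sub_sub_variational_le {q T : ℝ} (hq : q ∈ Ioo (0 : ℝ) 1) (hT : 0 < T)
    {K M : ℝ≥0} {g : E → E} (hgd : Differentiable ℝ g) (hg : LipschitzWith K g)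
    (hg' : LipschitzWith M (fderiv ℝ g)) {x₀ : E} {x : ℝ → E}
    (hx : IsCaputoSolution q T (fun _ => g) x₀ x) {Φ : ℝ → (E →L[ℝ] E)}
    (hΦ : IsCaputoSolution q T (fun t N => (fderiv ℝ g (x t)).comp N)
      (ContinuousLinearMap.id ℝ E) Φ) :
    ∃ C : ℝ, ∀ (y : E) (u : ℝ → E), IsCaputoSolution q T (fun _ => g) y u →
      ∀ t ∈ Icc 0 T, ‖u t - x t - Φ t (y - x₀)‖ ≤ C * ‖y - x₀‖ ^ 2 := by
  have := FiniteDimensional.complete ℝ E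
  obtain ⟨C, hC, hdep⟩ := exists_norm_sub_le (T := T) hq hT hg
  obtain ⟨D, -, H⟩ := exists_volterra_stability (E := E) hq hT (caputoConst_pos hq).le K.2
  refine ⟨D * (M * C ^ 2), fun y u hu t ht => ?_⟩
  have hxc := hx.continuousOn hT.le
  have hgu : ContinuousOn (fun s => g (u s)) (Icc 0 T) :=
    hg.continuous.comp_continuousOn (hu.continuousOn hT.le)
  have hgx : ContinuousOn (fun s => g (x s)) (Icc 0 T) := hg.continuous.comp_continuousOn hxc
  have hAΦ : ContinuousOn (fun s => (fderiv ℝ g (x s)).comp (Φ s)) (Icc 0 T) :=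
    (hg'.continuous.comp_continuousOn hxc).clm_comp (hΦ.continuousOn hT.le)
  have hAη : ContinuousOn (fun s => (fderiv ℝ g (x s)).comp (Φ s) (y - x₀)) (Icc 0 T) :=
    hAΦ.clm_apply continuousOn_const
  -- The source is the Taylor remainder of `g` at `x s`, at most `M ‖u s - x s‖²`, and `‖u s - x s‖
  -- ≤ C ‖y - x₀‖`.
  have h := H 0 (fun s => g (u s) - g (x s) - (fderiv ℝ g (x s)).comp (Φ s) (y - x₀))
    (fun s => u s - x s - Φ s (y - x₀)) (M * (C * ‖y - x₀‖) ^ 2) (by positivity)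
    ((hgu.sub hgx).sub hAη) (fun s hs => ?_) (fun s hs => ?_) t ht
  · refine h.trans (le_of_eq ?_)
    rw [norm_zero]
    ring
  · have hsub : Icc 0 s ⊆ Icc 0 T := Icc_subset_Icc_right hs.2
    have h1 : Φ s (y - x₀) = y - x₀ + caputoConst q •
        fracInt q (fun s => (fderiv ℝ g (x s)).comp (Φ s) (y - x₀)) s := by
      conv_lhs => rw [hΦ.eq_add_fracInt hq hs]
      have h2 := fracInt_clm_apply (ContinuousLinearMap.apply ℝ E (y - x₀)) hq.1 hs.1
        (hAΦ.mono hsub)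
      simp only [ContinuousLinearMap.apply_apply] at h2
      rw [add_apply, smul_apply, h2]
      rfl
    rw [h1, ← fracInt_sub hq.1 hs.1 (v := fun s => g (u s) - g (x s)) ((hgu.sub hgx).mono hsub) (hAη.mono hsub),
      ← fracInt_sub hq.1 hs.1 (hgu.mono hsub) (hgx.mono hsub), hu.eq_add_fracInt hq hs,
      hx.eq_add_fracInt hq hs, smul_sub, smul_sub]
    abel
  · have h1 : g (u s) - g (x s) - (fderiv ℝ g (x s)).comp (Φ s) (y - x₀) =
        fderiv ℝ g (x s) (u s - x s - Φ s (y - x₀)) +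
          (g (u s) - g (x s) - fderiv ℝ g (x s) (u s - x s)) := by
      rw [map_sub (fderiv ℝ g (x s)) (u s - x s), ContinuousLinearMap.comp_apply]
      abel
    rw [h1]
    refine (norm_add_le _ _).trans (add_le_add ?_ ?_)
    · exact ((fderiv ℝ g (x s)).le_opNorm _).trans
        (mul_le_mul_of_nonneg_right (norm_fderiv_le_of_lipschitz ℝ hg) (norm_nonneg _))
    · refine (norm_sub_sub_fderiv_le hgd hg' _ _).trans ?_
      have := hdep y x₀ u x hu hx s hs
      gcongr

end Solutions
-- The main theorem
theorem mainTheorem1 {n : ℕ} (q T : ℝ) (hq : q ∈ Ioo (0 : ℝ) 1) (hT : 0 < T)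
    (f : EuclideanSpace ℝ (Fin n) → EuclideanSpace ℝ (Fin n)) (hf : ContDiff ℝ 2 f) :
    -- a solution of `D_*^q x = f(x)` on `[0,T]` is determined by its initial value
    (∀ (y : EuclideanSpace ℝ (Fin n)) (u v : ℝ → EuclideanSpace ℝ (Fin n)),
      IsCaputoSolution q T (fun _ => f) y u → IsCaputoSolution q T (fun _ => f) y v →
        EqOn u v (Icc 0 T)) ∧
    -- if `f` is Lipschitz, every initial value has a solution on `[0,T]`
    (∀ K : ℝ≥0, LipschitzWith K f → ∀ y : EuclideanSpace ℝ (Fin n),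
      ∃ u : ℝ → EuclideanSpace ℝ (Fin n), IsCaputoSolution q T (fun _ => f) y u) ∧
    -- the variational system along any solution `x` on `[0,T]`
    (∀ (x₀ : EuclideanSpace ℝ (Fin n)) (x : ℝ → EuclideanSpace ℝ (Fin n)),
      IsCaputoSolution q T (fun _ => f) x₀ x →
      (∀ᶠ y in 𝓝 x₀, ∃ u : ℝ → EuclideanSpace ℝ (Fin n),
        IsCaputoSolution q T (fun _ => f) y u) ∧
      ∀ X : EuclideanSpace ℝ (Fin n) → ℝ → EuclideanSpace ℝ (Fin n),
        (∀ᶠ y in 𝓝 x₀, IsCaputoSolution q T (fun _ => f) y (X y)) →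
        ∃ Φ : ℝ → (EuclideanSpace ℝ (Fin n) →L[ℝ] EuclideanSpace ℝ (Fin n)),
          (∀ t ∈ Icc 0 T, HasFDerivAt (fun y => X y t) (Φ t) x₀) ∧
          IsCaputoSolution q T (fun t M => (fderiv ℝ f (x t)).comp M)
            (ContinuousLinearMap.id ℝ (EuclideanSpace ℝ (Fin n))) Φ ∧
          ∀ Ψ : ℝ → (EuclideanSpace ℝ (Fin n) →L[ℝ] EuclideanSpace ℝ (Fin n)),
            IsCaputoSolution q T (fun t M => (fderiv ℝ f (x t)).comp M)
              (ContinuousLinearMap.id ℝ (EuclideanSpace ℝ (Fin n))) Ψ →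
            EqOn Ψ Φ (Icc 0 T)) := by
  refine ⟨fun y u v hu hv => hu.eqOn_of_contDiff hq hT hf hv,
    fun K hK y => exists_isCaputoSolution hq hT hK y, fun x₀ x hx => ?_⟩
  obtain ⟨R, hR⟩ := hx.exists_norm_lt hT.le
  obtain ⟨g, K, M, hg2, hK, hM, hgf⟩ := exists_lipschitz_truncation hf (R + 1)
  have hlt : ∀ t ∈ Icc 0 T, ‖x t‖ < R + 1 := fun t ht => (hR t ht).trans (lt_add_one R)
  have hxg : IsCaputoSolution q T (fun _ => g) x₀ x := hx.congr fun t ht => ((hgf _ (hlt t ht)).1).symm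
  obtain ⟨C, hC, hdep⟩ := exists_norm_sub_le (T := T) hq hT hK
  -- Within `1 / C` of `x₀` the solution for `g` stays within `1` of `x`, hence in the ball of
  -- radius `R + 1` where `g = f`.
  have hball : ∀ᶠ y in 𝓝 x₀, ‖y - x₀‖ < 1 / C := by
    have h := Metric.ball_mem_nhds x₀ (show 0 < 1 / C by positivity)
    filter_upwards [h] with y hy
    rwa [← dist_eq_norm]
  have hsol : ∀ y, ‖y - x₀‖ < 1 / C → ∀ u, IsCaputoSolution q T (fun _ => g) y u →
      IsCaputoSolution q T (fun _ => f) y u := fun y hy u hu => hu.congr fun t ht => by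
    refine (hgf _ ?_).1
    have h1 := hdep y x₀ u x hu hxg t ht
    have h2 : C * ‖y - x₀‖ < 1 := by rwa [lt_div_iff₀' hC] at hy
    calc ‖u t‖ = ‖x t + (u t - x t)‖ := by rw [add_sub_cancel]
      _ ≤ ‖x t‖ + ‖u t - x t‖ := norm_add_le _ _
      _ < R + 1 := by linarith [hR t ht]
  refine ⟨?_, fun X hX => ?_⟩
  · filter_upwards [hball] with y hy
    obtain ⟨u, hu⟩ := exists_isCaputoSolution hq hT hK y
    exact ⟨u, hsol y hy u hu⟩
  obtain ⟨Φ, hΦ⟩ := exists_isCaputoSolution_variational hq hT hK hM hxg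
  have hΦf := hΦ.congr (G := fun t N => (fderiv ℝ f (x t)).comp N) fun t ht => by
    rw [(hgf _ (hlt t ht)).2]
  refine ⟨Φ, fun t ht => ?_, hΦf, fun Ψ hΨ => ?_⟩
  · obtain ⟨D, hD⟩ := exists_norm_sub_sub_variational_le hq hT (hg2.differentiable (by norm_num))
      hK hM hxg hΦ
    have hO : (fun y => X y t - x t - Φ t (y - x₀)) =O[𝓝 x₀] fun y => ‖y - x₀‖ ^ 2 := by
      refine Asymptotics.IsBigO.of_bound D ?_
      filter_upwards [hball, hX] with y hy hXy
      obtain ⟨u, hu⟩ := exists_isCaputoSolution hq hT hK y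
      -- Uniqueness for `f` identifies the given family `X` with the solutions for `g`.
      rw [hXy.eqOn_of_contDiff hq hT hf (hsol y hy u hu) ht, norm_pow, norm_norm]
      exact hD y u hu t ht
    -- A quadratically small remainder has derivative zero at `x₀`.
    have h1 := hO.hasFDerivAt (𝕜 := ℝ) one_lt_two
    have h2 : HasFDerivAt (fun y => x t + Φ t (y - x₀)) (Φ t) x₀ := by
      simpa using ((Φ t).hasFDerivAt.comp x₀ ((hasFDerivAt_id x₀).sub_const x₀)).const_add (x t)
    have h3 := h1.add h2
    rw [zero_add] at h3
    refine h3.congr_of_eventuallyEq (Eventually.of_forall fun y => ?_)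
    simp only [Pi.add_apply]
    abel
  · have hA : ContinuousOn (fun t => fderiv ℝ f (x t)) (Icc 0 T) :=
      (hf.continuous_fderiv (by norm_num)).comp_continuousOn (hx.continuousOn hT.le)
    refine hΨ.eqOn hq hT K.2 hΦf (hA.clm_comp (hΨ.continuousOn hT.le))
      (hA.clm_comp (hΦf.continuousOn hT.le)) fun t ht => ?_
    rw [← ContinuousLinearMap.comp_sub, ← (hgf _ (hlt t ht)).2]
    exact (ContinuousLinearMap.opNorm_comp_le _ _).trans
      (mul_le_mul_of_nonneg_right (norm_fderiv_le_of_lipschitz ℝ hK) (norm_nonneg _))
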